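/- Let $K\in\mathbb R$, $N\in[1,\infty)$ and $D\in(0,\infty]$; for $D=\infty$ read $[0,D]$ as $[0,\infty)$ and, more generally, $[x,x+D]$ as $[x,\infty)$. **Perimeter, content, profile.** Let $X\subset\mathbb R$ be a closed interval with the distance $|\cdot|$ and $m$ a Borel probability measure on $X$. For a Borel set $E\subset X$ put $$\mathsf P_{(X,|\cdot|,m)}(E)=\inf\Big\{\liminf_{n\to\infty}\int_X|\nabla u_n|\,dm:\ u_n\in\mathrm{Lip}(X),\ u_n\to\chi_E\text{ in }L^1(X,m)\Big\},\qquad |\nabla u|(x)=\limsup_{X\ni y\to x}\frac{|u(x)-u(y)|}{|x-y|},$$ $$m^+(E)=\liminf_{\varepsilon\downarrow0}\frac{m(E^\varepsilon)-m(E)}{\varepsilon},\qquad E^\varepsilon=\{x\in X:\ \mathrm{dist}(x,E)\le\varepsilon\},$$ $$\mathcal I_{(X,|\cdot|,m)}(v)=\inf\{\mathsf P_{(X,|\cdot|,m)}(E):\ E\subset X\text{ Borel},\ m(E)=v\}.$$ Values in $[0,\infty]$ are allowed and $\inf\emptyset=+\infty$; in particular $\mathrm{dist}(x,\emptyset)=+\infty$,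 so $\emptyset^\varepsilon=\emptyset$. **The family $\mathcal F^s_{K,N,D}$.** For $M>0$, $t\in[0,1]$ and $\theta>0$ let $$\sigma^{(t)}_{K,M}(\theta)=\begin{cases}\infty,&K\theta^2\ge M\pi^2,\\ \dfrac{\sin(t\theta\sqrt{K/M})}{\sin(\theta\sqrt{K/M})},&0<K\theta^2<M\pi^2,\\ t,&K=0,\\ \dfrac{\sinh(t\theta\sqrt{-K/M})}{\sinh(\theta\sqrt{-K/M})},&K<0.\end{cases}$$ $\mathcal F^s_{K,N,D}$ is the set of Borel probability measures $\mu=h_\mu\mathcal L^1$ on $\mathbb R$ with $\mathrm{supp}(\mu)\subset[0,D]$ and $h_\mu:\mathbb R\to[0,\infty)$ Borel and vanishing outside $\mathrm{supp}(\mu)$, such that * if $N>1$: $h_\mu$ is continuous on $\mathrm{supp}(\mu)$, and for all $t_0<t_1$ in $\mathrm{supp}(\mu)$ and $s\in[0,1]$ (with $\infty\cdot0=0$) $$h_\mu((1-s)t_0+st_1)^{\frac1{N-1}}\ge\sigma^{(1-s)}_{K,N-1}(t_1-t_0)\,h_\mu(t_0)^{\frac1{N-1}}+\sigma^{(s)}_{K,N-1}(t_1-t_0)\,h_\mu(t_1)^{\frac1{N-1}};$$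 * if $N=1$: $\mathrm{supp}(\mu)$ is an interval and $h_\mu$ is constant on it. **The model profile.** For $\delta\in\mathbb R$ let $s_\delta(t)=\sin(\sqrt\delta\,t)/\sqrt\delta$, $t$, $\sinh(\sqrt{-\delta}\,t)/\sqrt{-\delta}$ and $c_\delta(t)=\cos(\sqrt\delta\,t)$, $1$, $\cosh(\sqrt{-\delta}\,t)$ for $\delta>0$, $\delta=0$, $\delta<0$ respectively. For a continuous $f:\mathbb R\to\mathbb R$ with $f(0)\ge0$ let $f_+=f\chi_{[\xi_-,\xi_+]}$ with $\xi_-=\sup\{\xi\le0:f(\xi)=0\}$ and $\xi_+=\inf\{\xi>0:f(\xi)=0\}$ (where $\sup\emptyset=-\infty$, $\inf\emptyset=+\infty$). For $H\in\mathbb R$ and $\delta=K/(N-1)$ let $$J_{H,K,N}(t)=\begin{cases}\chi_{\{t=0\}},&N=1,\ K>0,\\ \chi_{\{Ht\ge0\}},&N=1,\ K\le0,\\ \big(c_\delta(t)+\tfrac{H}{N-1}s_\delta(t)\big)_+^{N-1},&N>1.\end{cases}$$ For a closed interval $L$ and $f\ge0$ on $L$, write $\mathcal I_{(L,f)}=\mathcal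 I_{(L,|\cdot|,\mu_{f,L})}$, where $\mu_{f,L}$ is the probability measure on $L$ with density proportional to $f$, if $0<\int_Lf<\infty$; put $\mathcal I_{(L,f)}=+\infty$ if $\int_Lf=0$ (such a pair is disregarded in the infimum below), and $\mathcal I_{(L,f)}=0$ if $\int_Lf=\infty$. Then $$\mathcal I_{K,N,D}(v)=\inf_{H\in\mathbb R,\ a\in[0,D],\ a<\infty}\mathcal I_{([-a,D-a],\,J_{H,K,N})}(v).$$ **Statement.** Let $\mu\in\mathcal F^s_{K,N,D}$ and $v\in[0,1]$. Then $$\inf\{\mathsf P_{([0,D],|\cdot|,\mu)}(E):\ E\subset[0,D]\text{ Borel},\ \mu(E)=v\}=\inf\{\mu^+(E):\ E\subset[0,D]\text{ Borel},\ \mu(E)=v\}.$$ If moreover $K\le0$ in case $N=1$, then this common value is at least $\mathcal I_{K,N,D}(v)$. -/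

import Mathlib

open Set Filter Topology MeasureTheory
open scoped ENNReal

noncomputable section

namespace Isoperimetric

/-! ### Perimeter, outer Minkowski content and isoperimetric profiles

The metric measure space `(X, d, m)` is given as a subset `X` of an ambient metric space `α`, with
the restricted distance, and a measure `m` on `α` of which only the restriction to `X` is used. -/

section MetricMeasure

variable {α : Type*} [MetricSpace α] [MeasurableSpace α]

/-- The slope `|∇u|(x) = limsup_{y → x} |u(x) - u(y)| / d(x, y)` of `u` at `x`, taken in the metric
space `X` (so `y` ranges over `X \ {x}`; at an isolated point of `X` the slope is `0`). -/
def slopeIn (X : Set α) (u : α → ℝ) (x : α) : ℝ≥0∞ :=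
  limsup (fun y => edist (u x) (u y) / edist x y) (𝓝[X \ {x}] x)

/-- `u n → χ_E` in `L¹(X, m)`. -/
def TendstoIndicatorL1 (X : Set α) (m : Measure α) (u : ℕ → α → ℝ) (E : Set α) : Prop :=
  Tendsto (fun n => ∫⁻ x in X, edist (u n x) (E.indicator (fun _ => (1 : ℝ)) x) ∂m) atTop (𝓝 0)

/-- The perimeter of `E` in `(X, d, m)`: the infimum of `liminf_n ∫_X |∇u_n| dm` over all sequences
of Lipschitz functions on `X` which converge to `χ_E` in `L¹(X, m)`. -/
def perimeter (X : Set α) (m : Measure α) (E : Set α) : ℝ≥0∞ :=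
  ⨅ (u : ℕ → α → ℝ) (_ : ∀ n, ∃ C, LipschitzOnWith C (u n) X) (_ : TendstoIndicatorL1 X m u E),
    liminf (fun n => ∫⁻ x in X, slopeIn X (u n) x ∂m) atTop

/-- The outer Minkowski content `liminf_{ε ↓ 0} (m(E^ε) - m(E)) / ε` of `E` in `(X, d, m)`, where
`E^ε = {x ∈ X : d(x, E) ≤ ε}` (empty if `E` is empty). -/
def outerMinkowskiContent (X : Set α) (m : Measure α) (E : Set α) : ℝ≥0∞ :=
  liminf (fun ε : ℝ => (m (X ∩ Metric.cthickening ε E) - m E) / ENNReal.ofReal ε) (𝓝[>] 0)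

/-- The isoperimetric profile of `(X, d, m)`: the infimum of the perimeter over the Borel sets
`E ⊆ X` with `m(E) = v`. -/
def perimeterProfile (X : Set α) (m : Measure α) (v : ℝ) : ℝ≥0∞ :=
  ⨅ (E : Set α) (_ : E ⊆ X) (_ : MeasurableSet E) (_ : m E = ENNReal.ofReal v), perimeter X m E

/-- The infimum of the outer Minkowski content over the Borel sets `E ⊆ X` with `m(E) = v`. -/
def contentProfile (X : Set α) (m : Measure α) (v : ℝ) : ℝ≥0∞ :=
  ⨅ (E : Set α) (_ : E ⊆ X) (_ : MeasurableSet E) (_ : m E = ENNReal.ofReal v),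
    outerMinkowskiContent X m E

end MetricMeasure

/-- The closed interval `[x, x + D]` of the real line, which is `[x, ∞)` if `D = ∞`. -/
def intervalFrom (x : ℝ) (D : ℝ≥0∞) : Set ℝ :=
  {t | x ≤ t ∧ ENNReal.ofReal (t - x) ≤ D}

/-! ### The family of one-dimensional measures -/

/-- The distortion coefficient `σ_{K,N}^{(t)}(θ)`. -/
def distortion (K N t θ : ℝ) : ℝ≥0∞ :=
  if N * Real.pi ^ 2 ≤ K * θ ^ 2 then ⊤
  else if 0 < K * θ ^ 2 then
    ENNReal.ofReal (Real.sin (t * θ * √(K / N)) / Real.sin (θ * √(K / N)))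
  else if K * θ ^ 2 = 0 ∨ N = 0 then ENNReal.ofReal t
  else ENNReal.ofReal (Real.sinh (t * θ * √(-K / N)) / Real.sinh (θ * √(-K / N)))

/-- The curvature-dimension inequality for a density `h` on a set `S ⊆ ℝ`:
`h((1-s) t₀ + s t₁)^{1/(N-1)} ≥ σ_{K,N-1}^{(1-s)}(t₁-t₀) h(t₀)^{1/(N-1)}
  + σ_{K,N-1}^{(s)}(t₁-t₀) h(t₁)^{1/(N-1)}` for `t₀ < t₁` in `S` and `s ∈ [0,1]`,
with the usual convention `∞ · 0 = 0`. -/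
def CurvatureInequality (K N : ℝ) (h : ℝ → ℝ) (S : Set ℝ) : Prop :=
  ∀ t₀ ∈ S, ∀ t₁ ∈ S, t₀ < t₁ → ∀ s ∈ Icc (0 : ℝ) 1,
    distortion K (N - 1) (1 - s) (t₁ - t₀) * ENNReal.ofReal (h t₀ ^ (1 / (N - 1)))
        + distortion K (N - 1) s (t₁ - t₀) * ENNReal.ofReal (h t₁ ^ (1 / (N - 1)))
      ≤ ENNReal.ofReal (h ((1 - s) * t₀ + s * t₁) ^ (1 / (N - 1)))

/-- The family `F^s_{K,N,D}` of Borel probability measures `μ = h · 𝓛¹` on the line with support in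
`[0, D]`, where `h` vanishes outside the support and, on the support, is continuous and satisfies
the curvature-dimension inequality if `N > 1`, and is constant if `N = 1`. The support is an
interval: for `N > 1` this follows from the inequality, for `N = 1` it is part of the definition. -/
def syntheticFamily (K N : ℝ) (D : ℝ≥0∞) : Set (Measure ℝ) :=
  {μ | IsProbabilityMeasure μ ∧ μ.support ⊆ intervalFrom 0 D ∧
    ∃ h : ℝ → ℝ, Measurable h ∧ (∀ t, 0 ≤ h t) ∧ (∀ t, t ∉ μ.support → h t = 0) ∧
      μ = volume.withDensity (fun t => ENNReal.ofReal (h t)) ∧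
      (1 < N → ContinuousOn h μ.support ∧ CurvatureInequality K N h μ.support) ∧
      (N = 1 → μ.support.OrdConnected ∧ ∃ c, ∀ t ∈ μ.support, h t = c)}

/-! ### The model isoperimetric profile -/

/-- The function `s_δ`. -/
def sn (δ t : ℝ) : ℝ :=
  if 0 < δ then Real.sin (√δ * t) / √δ
  else if δ = 0 then t
  else Real.sinh (√(-δ) * t) / √(-δ)

/-- The function `c_δ`. -/
def cs (δ t : ℝ) : ℝ :=
  if 0 < δ then Real.cos (√δ * t)
  else if δ = 0 then 1
  else Real.cosh (√(-δ) * t)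

/-- The last root of `f` in `(-∞, 0]`, which is `-∞` if there is none. -/
def lowerRoot (f : ℝ → ℝ) : EReal := sSup ((fun ξ : ℝ => (ξ : EReal)) '' {ξ | ξ ≤ 0 ∧ f ξ = 0})

/-- The first root of `f` in `(0, ∞)`, which is `+∞` if there is none. -/
def upperRoot (f : ℝ → ℝ) : EReal := sInf ((fun ξ : ℝ => (ξ : EReal)) '' {ξ | 0 < ξ ∧ f ξ = 0})

/-- `f₊`: the function that agrees with `f` between its last non-positive and its first positive
root, and vanishes everywhere else. -/
def betweenRoots (f : ℝ → ℝ) : ℝ → ℝ :=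
  {t : ℝ | lowerRoot f ≤ t ∧ (t : EReal) ≤ upperRoot f}.indicator f

/-- The model density `J_{H,K,N}`, for `N ≥ 1`. -/
def modelDensity (H K N : ℝ) : ℝ → ℝ :=
  if N = 1 then
    if 0 < K then ({0} : Set ℝ).indicator (fun _ => 1)
    else {t : ℝ | 0 ≤ H * t}.indicator (fun _ => 1)
  else fun t =>
    betweenRoots (fun r => cs (K / (N - 1)) r + H / (N - 1) * sn (K / (N - 1)) r) t ^ (N - 1)

/-- The mass of the density `f` on `L`. -/
def mass (L : Set ℝ) (f : ℝ → ℝ) : ℝ≥0∞ := ∫⁻ t in L, ENNReal.ofReal (f t)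

/-- `μ_{f,L}`: the probability measure on `L` whose density is proportional to `f` there
(meaningful if `f` has positive and finite mass on `L`). -/
def normalizedMeasure (L : Set ℝ) (f : ℝ → ℝ) : Measure ℝ :=
  (mass L f)⁻¹ • (volume.restrict L).withDensity (fun t => ENNReal.ofReal (f t))

open Classical in
/-- The profile `I_{(L,f)}` of `(L, |·|, μ_{f,L})`. If `f` has no mass on `L`, there is no such
measure and the value is `+∞`, so that the pair is disregarded in an infimum; if `f` is not
integrable on `L` (which happens only for unbounded `L` below), the profile is trivial, that is `0`. -/
def densityProfile (L : Set ℝ) (f : ℝ → ℝ) (v : ℝ) : ℝ≥0∞ :=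
  if mass L f = 0 then ⊤
  else if mass L f = ⊤ then 0
  else perimeterProfile L (normalizedMeasure L f) v

/-- The model isoperimetric profile `I_{K,N,D}(v)`: the infimum of the profiles of
`([-a, D - a], J_{H,K,N})` over `H ∈ ℝ` and (finite) `a ∈ [0, D]`. -/
def modelProfile (K N : ℝ) (D : ℝ≥0∞) (v : ℝ) : ℝ≥0∞ :=
  ⨅ (H : ℝ) (a : ℝ) (_ : a ∈ intervalFrom 0 D), densityProfile (intervalFrom (-a) D) (modelDensity H K N) v

end Isoperimetric

end

noncomputable section

namespace Isoperimetric

/-! ### The slope on the line, and the perimeter as a lower bound of the Minkowski content -/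

/-! A measure of the family is carried by an open interval `I` on which its density `h` is
continuous and positive, so that perimeter amounts to counting boundary points with weight `h`.
Minkowski content dominates perimeter because cutoffs in the distance to the set are admissible
competitors. Conversely, where both `E` and its complement have positive measure near a point `x` of
`I`, functions converging to the indicator must pass from nearly 1 to nearly 0, which costs nearly
`h x`; hence the sum of `h` over `essBoundary` is at most the perimeter (`sum_le_perimeter`). If the
perimeter is finite, this boundary is countable, `E` has the measure of the open set `essInterior`,
and the ends in `I` of its components are distinct boundary points (`sum_cost_le_perimeter`).

Equality of the profiles: a finite union of components has content at most the cost of its ends. If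
no finite union has full mass, finitely many components are kept and the lost mass is recovered
exactly by pushing one end slightly into a neighbouring gap (`exists_contentLE`).

Comparison: the curvature inequality says that `h ^ (1 / (N - 1))` is concave relative to the
solutions of `f'' + K / (N - 1) * f = 0`. A supporting solution at `x` bounds `h` by `h x` times a
translated model density, so the masses on the two sides of `x` are at most `h x` times the model
masses of two halves of total length `D` (`halvesBound_Iio`). Such bounds add up
(`HalvesBound.add`): of two pieces, the model belonging to the one with more mass per cost serves
both. So one model and one splitting of `D` work for all ends together. Moving the cut of that model
until it has the share `v` preserves one of the two bounds, which forces the total model mass to be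
at least the inverse of the cost; the half-line in the model then has no larger perimeter
(`HalvesBound.modelProfile_le`). -/

theorem tendsto_edist_div_edist {u : ℝ → ℝ} {u' x : ℝ} (X : Set ℝ) (hu : HasDerivAt u u' x) :
    Tendsto (fun y => edist (u x) (u y) / edist x y) (𝓝[X \ {x}] x) (𝓝 ‖u'‖ₑ) := by
  have h1 : Tendsto (slope u x) (𝓝[X \ {x}] x) (𝓝 u') :=
    (hasDerivAt_iff_tendsto_slope.1 hu).mono_left (nhdsWithin_mono _ (fun y hy => hy.2))
  refine (h1.enorm).congr' ?_
  filter_upwards [self_mem_nhdsWithin] with y hy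
  have hne : y - x ≠ 0 := sub_ne_zero.2 hy.2
  rw [slope_def_field, div_eq_mul_inv, enorm_mul, enorm_inv hne, edist_comm, edist_comm x,
    edist_eq_enorm_sub, edist_eq_enorm_sub, div_eq_mul_inv]

theorem slopeIn_le_enorm_deriv {u : ℝ → ℝ} {u' x : ℝ} (X : Set ℝ) (hu : HasDerivAt u u' x) :
    slopeIn X u x ≤ ‖u'‖ₑ := by
  rcases eq_or_neBot (𝓝[X \ {x}] x) with h | h
  · simp [slopeIn, h]
  · exact (tendsto_edist_div_edist X hu).limsup_eq.le

theorem slopeIn_eq_enorm_deriv {u : ℝ → ℝ} {u' x : ℝ} {X : Set ℝ} (hx : X ∈ 𝓝 x)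
    (hu : HasDerivAt u u' x) : slopeIn X u x = ‖u'‖ₑ := by
  have : 𝓝[X \ {x}] x = 𝓝[≠] x := by
    rw [sdiff_eq, inter_comm, nhdsWithin_inter_of_mem' (mem_nhdsWithin_of_mem_nhds hx)]
  have : (𝓝[X \ {x}] x).NeBot := by rw [this]; infer_instance
  exact (tendsto_edist_div_edist X hu).limsup_eq

theorem slopeIn_le_of_lipschitzWith {u : ℝ → ℝ} {C : NNReal} (X : Set ℝ) (hu : LipschitzWith C u)
    (x : ℝ) : slopeIn X u x ≤ C := by
  refine limsup_le_of_le (by isBoundedDefault) (Eventually.of_forall fun y => ?_)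
  exact ENNReal.div_le_of_le_mul (hu x y)

theorem slopeIn_congr {u w : ℝ → ℝ} {X : Set ℝ} (h : EqOn u w X) {x : ℝ} (hx : x ∈ X) :
    slopeIn X u x = slopeIn X w x := by
  refine limsup_congr ?_
  filter_upwards [self_mem_nhdsWithin] with y hy
  rw [h hx, h hy.1]

/-- The function that is `1` on `E`, vanishes at distance at least `ε` from `E`, and is affine in
the distance in between. -/
def cutoff (E : Set ℝ) (ε : ℝ) (x : ℝ) : ℝ := max 0 (1 - Metric.infDist x E / ε)

theorem lipschitzWith_cutoff (E : Set ℝ) {ε : ℝ} (hε : 0 < ε) :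
    LipschitzWith (Real.toNNReal (1 / ε)) (cutoff E ε) := by
  have : LipschitzWith (Real.toNNReal (1 / ε)) (fun x => 1 - Metric.infDist x E / ε) := by
    refine LipschitzWith.of_dist_le_mul fun x y => ?_
    have h := (Metric.lipschitz_infDist_pt E).dist_le_mul x y
    rw [Real.coe_toNNReal _ (by positivity), Real.dist_eq]
    rw [Real.dist_eq] at h
    have : (1 - Metric.infDist x E / ε) - (1 - Metric.infDist y E / ε)
        = -(1 / ε * (Metric.infDist x E - Metric.infDist y E)) := by ring
    rw [this, abs_neg, abs_mul, abs_of_pos (by positivity : 0 < 1 / ε)]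
    gcongr
    simpa using h
  exact this.const_max 0

theorem cutoff_nonneg (E : Set ℝ) (ε x : ℝ) : 0 ≤ cutoff E ε x := le_max_left _ _

theorem cutoff_le_one (E : Set ℝ) {ε : ℝ} (hε : 0 < ε) (x : ℝ) : cutoff E ε x ≤ 1 := by
  refine max_le zero_le_one ?_
  have : 0 ≤ Metric.infDist x E / ε := div_nonneg Metric.infDist_nonneg hε.le
  linarith

theorem cutoff_of_mem {E : Set ℝ} {x : ℝ} (ε : ℝ) (hx : x ∈ E) : cutoff E ε x = 1 := by
  simp [cutoff, Metric.infDist_zero_of_mem hx]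

theorem cutoff_of_notMem {E : Set ℝ} (hE : E.Nonempty) {ε x : ℝ} (hε : 0 < ε)
    (hx : x ∉ Metric.cthickening ε E) : cutoff E ε x = 0 := by
  have h : ε < Metric.infDist x E := by
    by_contra! h
    apply hx
    rw [Metric.mem_cthickening_iff]
    rw [Metric.infDist] at h
    exact (ENNReal.le_ofReal_iff_toReal_le (Metric.infEDist_ne_top hE) hε.le).2 h
  refine max_eq_left ?_
  have : 1 < Metric.infDist x E / ε := (one_lt_div hε).2 h
  linarith

/-- Each point of `E` is a maximum of the cutoff, so the derivative vanishes there whenever it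
exists, which is almost everywhere. No topological regularity of `E` is needed. -/
theorem ae_slopeIn_cutoff_eq_zero (X E : Set ℝ) {ε : ℝ} (hε : 0 < ε) :
    ∀ᵐ x, x ∈ E → slopeIn X (cutoff E ε) x = 0 := by
  filter_upwards [(lipschitzWith_cutoff E hε).ae_differentiableAt_real] with x hx hxE
  have hmax : IsLocalMax (cutoff E ε) x :=
    Eventually.of_forall fun y => by
      rw [cutoff_of_mem ε hxE]; exact cutoff_le_one E hε y
  have := slopeIn_le_enorm_deriv X hx.hasDerivAt
  rw [hmax.deriv_eq_zero] at this
  simpa using this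

theorem slopeIn_cutoff_of_notMem (X : Set ℝ) {E : Set ℝ} (hE : E.Nonempty) {ε x : ℝ} (hε : 0 < ε)
    (hx : x ∉ Metric.cthickening ε E) : slopeIn X (cutoff E ε) x = 0 := by
  have h : cutoff E ε =ᶠ[𝓝 x] fun _ => 0 := by
    filter_upwards [Metric.isClosed_cthickening.isOpen_compl.mem_nhds hx] with y hy
    exact cutoff_of_notMem hE hε hy
  have := slopeIn_le_enorm_deriv X ((hasDerivAt_const x (0 : ℝ)).congr_of_eventuallyEq h)
  simpa using this

theorem lintegral_slopeIn_cutoff_le {X E : Set ℝ} {m : Measure ℝ} [IsFiniteMeasure m]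
    (hm : m ≪ volume) (hEX : E ⊆ X) (hE : MeasurableSet E)
    (hne : E.Nonempty) {ε : ℝ} (hε : 0 < ε) :
    ∫⁻ x in X, slopeIn X (cutoff E ε) x ∂m
      ≤ (m (X ∩ Metric.cthickening ε E) - m E) / ENNReal.ofReal ε := by
  have hcth : MeasurableSet (Metric.cthickening ε E) := Metric.isClosed_cthickening.measurableSet
  have hsub : E ⊆ X ∩ Metric.cthickening ε E :=
    subset_inter hEX (Metric.self_subset_cthickening E)
  calc ∫⁻ x in X, slopeIn X (cutoff E ε) x ∂m
      ≤ ∫⁻ x in X, ((Metric.cthickening ε E) \ E).indicator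
          (fun _ => ((Real.toNNReal (1 / ε) : NNReal) : ℝ≥0∞)) x ∂m := by
        refine lintegral_mono_ae (ae_restrict_of_ae ?_)
        filter_upwards [hm.ae_le (ae_slopeIn_cutoff_eq_zero X E hε)] with x hx
        by_cases hxE : x ∈ E
        · simp [hx hxE]
        by_cases hxc : x ∈ Metric.cthickening ε E
        · rw [indicator_of_mem (show x ∈ Metric.cthickening ε E \ E from ⟨hxc, hxE⟩)]
          exact slopeIn_le_of_lipschitzWith X (lipschitzWith_cutoff E hε) x
        · simp [slopeIn_cutoff_of_notMem X hne hε hxc]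
    _ = (Real.toNNReal (1 / ε) : NNReal) * m ((X ∩ Metric.cthickening ε E) \ E) := by
        rw [lintegral_indicator_const (hcth.diff hE), Measure.restrict_apply (hcth.diff hE)]
        congr 2
        ext x; simp only [mem_inter_iff, Set.mem_sdiff]; tauto
    _ = _ := by
        rw [measure_sdiff hsub hE.nullMeasurableSet (measure_ne_top m E), ENNReal.div_eq_inv_mul]
        congr 1
        rw [one_div, ← ENNReal.ofReal_inv_of_pos hε]
        rfl

theorem lintegral_edist_cutoff_le {X E : Set ℝ} {m : Measure ℝ} [IsFiniteMeasure m]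
    (hEX : E ⊆ X) (hE : MeasurableSet E)
    (hne : E.Nonempty) {ε : ℝ} (hε : 0 < ε) :
    ∫⁻ x in X, edist (cutoff E ε x) (E.indicator (fun _ => (1 : ℝ)) x) ∂m
      ≤ m (X ∩ Metric.cthickening ε E) - m E := by
  have hcth : MeasurableSet (Metric.cthickening ε E) := Metric.isClosed_cthickening.measurableSet
  have hsub : E ⊆ X ∩ Metric.cthickening ε E :=
    subset_inter hEX (Metric.self_subset_cthickening E)
  calc _ ≤ ∫⁻ x in X, ((Metric.cthickening ε E) \ E).indicator (fun _ => (1 : ℝ≥0∞)) x ∂m := by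
        refine lintegral_mono fun x => ?_
        by_cases hxE : x ∈ E
        · simp [hxE, cutoff_of_mem]
        by_cases hxc : x ∈ Metric.cthickening ε E
        · rw [indicator_of_mem (show x ∈ Metric.cthickening ε E \ E from ⟨hxc, hxE⟩)]
          simp only [indicator_of_notMem hxE]
          rw [edist_dist, Real.dist_eq, sub_zero, abs_of_nonneg (cutoff_nonneg _ _ _)]
          exact ENNReal.ofReal_le_one.2 (cutoff_le_one E hε x)
        · simp [cutoff_of_notMem hne hε hxc, hxE]
    _ = m ((X ∩ Metric.cthickening ε E) \ E) := by
        rw [lintegral_indicator_const (hcth.diff hE), Measure.restrict_apply (hcth.diff hE), one_mul]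
        congr 1
        ext x; simp only [mem_inter_iff, Set.mem_sdiff]; tauto
    _ = _ := measure_sdiff hsub hE.nullMeasurableSet (measure_ne_top m E)

theorem perimeter_empty (X : Set ℝ) (m : Measure ℝ) : perimeter X m ∅ = 0 := by
  refine le_antisymm ?_ zero_le
  refine iInf_le_of_le (fun _ _ => 0) (iInf_le_of_le (fun n => ⟨0, (LipschitzWith.const (0 : ℝ)).lipschitzOnWith⟩)
    (iInf_le_of_le ?_ ?_))
  · simp [TendstoIndicatorL1]
  · have : ∀ x, slopeIn X (fun _ => (0 : ℝ)) x = 0 := fun x => by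
      simpa using slopeIn_le_enorm_deriv X (hasDerivAt_const x (0 : ℝ))
    simp [this]

/-- The cutoffs along a sequence of widths that nearly realizes the liminf are competitors. A
bounded quotient forces the measure of the collar to tend to 0, and this is the convergence in `L¹`.
-/
theorem perimeter_le_outerMinkowskiContent {X E : Set ℝ} {m : Measure ℝ} [IsFiniteMeasure m]
    (hm : m ≪ volume) (hEX : E ⊆ X) (hE : MeasurableSet E) :
    perimeter X m E ≤ outerMinkowskiContent X m E := by
  rcases E.eq_empty_or_nonempty with rfl | hne
  · simp [perimeter_empty]
  refine le_of_forall_gt fun c hc => ?_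
  obtain ⟨c', hc', hc'c⟩ := exists_between hc
  have hfreq := frequently_lt_of_liminf_lt (by isBoundedDefault) hc'
  have hfreq2 := hfreq.and_eventually (self_mem_nhdsWithin : Ioi (0 : ℝ) ∈ 𝓝[>] 0)
  obtain ⟨e, he, hlt⟩ := exists_seq_forall_of_frequently hfreq2
  have hpos : ∀ n, 0 < e n := fun n => (hlt n).2
  have he0 : Tendsto e atTop (𝓝 0) := he.mono_right nhdsWithin_le_nhds
  refine lt_of_le_of_lt ?_ hc'c
  refine iInf_le_of_le (fun n => cutoff E (e n))
    (iInf_le_of_le (fun n => ⟨_, (lipschitzWith_cutoff E (hpos n)).lipschitzOnWith⟩)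
    (iInf_le_of_le ?_ ?_))
  · have hc'top : c' ≠ ⊤ := (lt_of_lt_of_le hc'c le_top).ne
    have h0 : Tendsto (fun n => c' * ENNReal.ofReal (e n)) atTop (𝓝 0) := by
      have := ENNReal.Tendsto.const_mul (a := c') (ENNReal.tendsto_ofReal he0) (Or.inr hc'top)
      simpa using this
    refine tendsto_of_tendsto_of_tendsto_of_le_of_le tendsto_const_nhds h0 (fun _ => zero_le)
      fun n => (lintegral_edist_cutoff_le hEX hE hne (hpos n)).trans ?_
    have h1 := (hlt n).1.le
    rwa [ENNReal.div_le_iff (by simpa using hpos n) ENNReal.ofReal_ne_top] at h1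
  · refine liminf_le_of_le (by isBoundedDefault) fun b hb => ?_
    obtain ⟨n, hn⟩ := hb.exists
    exact hn.trans ((lintegral_slopeIn_cutoff_le hm hEX hE hne (hpos n)).trans (hlt n).1.le)

/-! ### Upper bounds for the Minkowski content -/

/-- The upper outer Minkowski content of `E` is at most `p`. -/
def ContentLE (X : Set ℝ) (m : Measure ℝ) (E : Set ℝ) (p : ℝ≥0∞) : Prop :=
  ∀ c > p, ∀ᶠ ε : ℝ in 𝓝[>] 0,
    m (X ∩ Metric.cthickening ε E) ≤ m E + ENNReal.ofReal ε * c

theorem ContentLE.outerMinkowskiContent_le {X E : Set ℝ} {m : Measure ℝ} [IsFiniteMeasure m]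
    {p : ℝ≥0∞} (h : ContentLE X m E p) : outerMinkowskiContent X m E ≤ p := by
  refine le_of_forall_gt_imp_ge_of_dense fun c hc => ?_
  refine liminf_le_of_frequently_le' (Eventually.frequently ?_)
  filter_upwards [h c hc, self_mem_nhdsWithin] with ε hε hpos
  rw [ENNReal.div_le_iff (by simpa using hpos) ENNReal.ofReal_ne_top, tsub_le_iff_left, mul_comm c]
  exact hε

theorem ContentLE.mono {X E : Set ℝ} {m : Measure ℝ} {p q : ℝ≥0∞} (h : ContentLE X m E p)
    (hpq : p ≤ q) : ContentLE X m E q := fun c hc => h c (hpq.trans_lt hc)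

theorem contentLE_empty (X : Set ℝ) (m : Measure ℝ) : ContentLE X m ∅ 0 := fun c _ => by simp

theorem exists_add_lt_of_add_lt {p q c : ℝ≥0∞} (h : p + q < c) :
    ∃ p' q', p < p' ∧ q < q' ∧ p' + q' ≤ c := by
  have hp : p ≠ ⊤ := fun hp => by simp [hp] at h
  have hq : q ≠ ⊤ := fun hq => by simp [hq] at h
  obtain ⟨d, hd, hdc⟩ := ENNReal.lt_iff_exists_add_pos_lt.1 h
  have hd2 : (d : ℝ≥0∞) / 2 ≠ 0 := by simpa using hd.ne'
  refine ⟨p + d / 2, q + d / 2, ENNReal.lt_add_right hp hd2, ENNReal.lt_add_right hq hd2, ?_⟩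
  calc p + (d : ℝ≥0∞) / 2 + (q + (d : ℝ≥0∞) / 2) = p + q + ((d : ℝ≥0∞) / 2 + d / 2) := by ring
    _ ≤ c := by rw [ENNReal.add_halves]; exact hdc.le

/-- This is why upper contents are used: limsups are subadditive, liminfs are not. -/
theorem ContentLE.union {X E F : Set ℝ} {m : Measure ℝ} {p q : ℝ≥0∞} (hE : ContentLE X m E p)
    (hF : ContentLE X m F q) (hEF : Disjoint E F) (hFm : MeasurableSet F) :
    ContentLE X m (E ∪ F) (p + q) := by
  intro c hc
  obtain ⟨p', q', hp, hq, hpq⟩ := exists_add_lt_of_add_lt hc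
  filter_upwards [hE p' hp, hF q' hq] with ε h1 h2
  rw [Metric.cthickening_union, inter_union_distrib_left]
  calc _ ≤ _ := measure_union_le _ _
    _ ≤ (m E + ENNReal.ofReal ε * p') + (m F + ENNReal.ofReal ε * q') := add_le_add h1 h2
    _ = m (E ∪ F) + ENNReal.ofReal ε * (p' + q') := by
        rw [measure_union hEF hFm]; ring
    _ ≤ _ := by gcongr

theorem ContentLE.biUnion {ι : Type*} {X : Set ℝ} {m : Measure ℝ} (s : Finset ι) (E : ι → Set ℝ)
    (p : ι → ℝ≥0∞) (h : ∀ i ∈ s, ContentLE X m (E i) (p i)) (hm : ∀ i ∈ s, MeasurableSet (E i))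
    (hd : (s : Set ι).PairwiseDisjoint E) : ContentLE X m (⋃ i ∈ s, E i) (∑ i ∈ s, p i) := by
  classical
  induction s using Finset.induction_on with
  | empty => simpa using contentLE_empty X m
  | insert a s ha ih =>
    rw [Finset.set_biUnion_insert, Finset.sum_insert ha]
    refine (h a (by simp)).union (ih (fun i hi => h i (by simp [hi])) (fun i hi => hm i (by simp [hi]))
      (hd.subset (by simp))) ?_ (s.measurableSet_biUnion fun i hi => hm i (by simp [hi]))
    rw [disjoint_iUnion₂_right]
    intro i hi
    exact hd (by simp) (by simp [hi]) (fun h => ha (h ▸ hi))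

/-- The part of `E^ε` above `E` has measure at most `ε (p + o(1))`. -/
def UpperCostLE (m : Measure ℝ) (C : Set ℝ) (p : ℝ≥0∞) : Prop :=
  ∀ c > p, ∀ᶠ ε : ℝ in 𝓝[>] 0,
    m (upperBounds C ∩ Metric.cthickening ε C) ≤ ENNReal.ofReal ε * c

/-- The part of `E^ε` below `E` has measure at most `ε (p + o(1))`. -/
def LowerCostLE (m : Measure ℝ) (C : Set ℝ) (p : ℝ≥0∞) : Prop :=
  ∀ c > p, ∀ᶠ ε : ℝ in 𝓝[>] 0,
    m (lowerBounds C ∩ Metric.cthickening ε C) ≤ ENNReal.ofReal ε * c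

theorem upperCostLE_of_null {m : Measure ℝ} {C : Set ℝ} (h : m (upperBounds C) = 0) :
    UpperCostLE m C 0 := fun c _ => Eventually.of_forall fun ε => by
  rw [measure_mono_null inter_subset_left h]; exact zero_le

theorem lowerCostLE_of_null {m : Measure ℝ} {C : Set ℝ} (h : m (lowerBounds C) = 0) :
    LowerCostLE m C 0 := fun c _ => Eventually.of_forall fun ε => by
  rw [measure_mono_null inter_subset_left h]; exact zero_le

theorem compl_subset_bounds {C : Set ℝ} (hC : C.OrdConnected) :
    Cᶜ ⊆ upperBounds C ∪ lowerBounds C := by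
  intro x hxC
  by_cases hu : x ∈ upperBounds C
  · exact Or.inl hu
  refine Or.inr fun y hy => ?_
  by_contra! hlt
  simp only [upperBounds, mem_ofPred_eq, not_forall, not_le] at hu
  obtain ⟨z, hz, hxz⟩ := hu
  exact hxC (hC.out hy hz ⟨hlt.le, hxz.le⟩)

/-- A point outside an order-connected set lies above all of it or below all of it, so its two ends
can be charged separately. -/
theorem contentLE_of_ordConnected (X : Set ℝ) {m : Measure ℝ} {C : Set ℝ} (hC : C.OrdConnected)
    {p q : ℝ≥0∞} (hp : UpperCostLE m C p) (hq : LowerCostLE m C q) :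
    ContentLE X m C (p + q) := by
  intro c hc
  obtain ⟨p', q', hp', hq', hpq⟩ := exists_add_lt_of_add_lt hc
  filter_upwards [hp p' hp', hq q' hq'] with ε h1 h2
  have hsub : X ∩ Metric.cthickening ε C ⊆ C ∪ (upperBounds C ∩ Metric.cthickening ε C ∪
      lowerBounds C ∩ Metric.cthickening ε C) := by
    rintro x ⟨-, hx⟩
    by_cases hxC : x ∈ C
    · exact Or.inl hxC
    exact Or.inr <| (compl_subset_bounds hC hxC).imp (fun h => ⟨h, hx⟩) fun h => ⟨h, hx⟩
  calc _ ≤ _ := measure_mono hsub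
    _ ≤ m C + (ENNReal.ofReal ε * p' + ENNReal.ofReal ε * q') :=
        (measure_union_le _ _).trans (add_le_add le_rfl ((measure_union_le _ _).trans
          (add_le_add h1 h2)))
    _ ≤ _ := by rw [← mul_add]; gcongr

theorem eventually_withDensity_Icc_le {k : ℝ → ℝ} {r : ℝ} (hk : ContinuousAt k r) {c : ℝ≥0∞}
    (hc : ENNReal.ofReal (k r) < c) :
    ∀ᶠ ε : ℝ in 𝓝[>] 0, ∀ a b, r - ε ≤ a → b ≤ r + ε → b - a ≤ ε →
      volume.withDensity (fun t => ENNReal.ofReal (k t)) (Icc a b) ≤ ENNReal.ofReal ε * c := by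
  have h1 : ∀ᶠ t in 𝓝 r, ENNReal.ofReal (k t) < c :=
    ((ENNReal.continuous_ofReal.continuousAt).comp hk).eventually_lt_const hc
  obtain ⟨δ, hδ, hball⟩ := Metric.eventually_nhds_iff.1 h1
  filter_upwards [Ioo_mem_nhdsGT hδ] with ε hε a b ha hb hab
  rw [withDensity_apply _ measurableSet_Icc]
  calc _ ≤ ∫⁻ _ in Icc a b, c := by
        refine setLIntegral_mono' measurableSet_Icc fun t ht => (hball ?_).le
        rw [Real.dist_eq, abs_lt]
        constructor <;> linarith [ht.1, ht.2, hε.2]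
    _ = c * ENNReal.ofReal (b - a) := by simp
    _ ≤ _ := by rw [mul_comm]; gcongr

theorem cthickening_subset_Iic {C : Set ℝ} {r ε : ℝ} (hε : 0 < ε) (h : r ∈ upperBounds C) :
    Metric.cthickening ε C ⊆ Iic (r + ε) := by
  have hC : C ⊆ Iic r := fun x hx => h hx
  refine (Metric.cthickening_subset_of_subset ε hC).trans ?_
  rw [isClosed_Iic.cthickening_eq_biUnion_closedBall hε.le]
  refine iUnion₂_subset fun y hy x hx => ?_
  rw [Metric.mem_closedBall, Real.dist_eq, abs_le] at hx
  simp only [mem_Iic] at hy ⊢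
  linarith

theorem cthickening_subset_Ici {C : Set ℝ} {r ε : ℝ} (hε : 0 < ε) (h : r ∈ lowerBounds C) :
    Metric.cthickening ε C ⊆ Ici (r - ε) := by
  have hC : C ⊆ Ici r := fun x hx => h hx
  refine (Metric.cthickening_subset_of_subset ε hC).trans ?_
  rw [isClosed_Ici.cthickening_eq_biUnion_closedBall hε.le]
  refine iUnion₂_subset fun y hy x hx => ?_
  rw [Metric.mem_closedBall, Real.dist_eq, abs_le] at hx
  simp only [mem_Ici] at hy ⊢
  linarith

/-- Domination by `k` suffices, so a measure that is truncated at the end of an interval is covered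
as well. -/
theorem upperCostLE_of_isLUB {m : Measure ℝ} {C : Set ℝ} {k : ℝ → ℝ} {r : ℝ}
    (hm : m ≤ volume.withDensity (fun t => ENNReal.ofReal (k t))) (hr : IsLUB C r)
    (hk : ContinuousAt k r) : UpperCostLE m C (ENNReal.ofReal (k r)) := by
  intro c hc
  filter_upwards [eventually_withDensity_Icc_le hk hc, self_mem_nhdsWithin] with ε h hε
  rw [mem_Ioi] at hε
  refine (measure_mono (t := Icc r (r + ε)) ?_).trans
    ((hm _).trans (h r (r + ε) (by linarith) le_rfl (by linarith)))
  exact fun x hx => ⟨hr.2 hx.1, cthickening_subset_Iic hε hr.1 hx.2⟩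

theorem lowerCostLE_of_isGLB {m : Measure ℝ} {C : Set ℝ} {k : ℝ → ℝ} {r : ℝ}
    (hm : m ≤ volume.withDensity (fun t => ENNReal.ofReal (k t))) (hr : IsGLB C r)
    (hk : ContinuousAt k r) : LowerCostLE m C (ENNReal.ofReal (k r)) := by
  intro c hc
  filter_upwards [eventually_withDensity_Icc_le hk hc, self_mem_nhdsWithin] with ε h hε
  rw [mem_Ioi] at hε
  refine (measure_mono (t := Icc (r - ε) r) ?_).trans
    ((hm _).trans (h (r - ε) r le_rfl (by linarith) (by linarith)))
  exact fun x hx => ⟨cthickening_subset_Ici hε hr.1 hx.2, hr.2 hx.1⟩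

/-! ### Lower bounds for the perimeter -/

/-- A Lipschitz extension to the line is absolutely continuous, so its increment is at most the
integral of its derivative, whose absolute value is the slope almost everywhere inside. -/
theorem mul_edist_le_lintegral_slopeIn {X : Set ℝ} {u : ℝ → ℝ} {C : NNReal}
    (hu : LipschitzOnWith C u X) {h : ℝ → ℝ} (hh : Measurable h) {c : ℝ≥0∞} {p q : ℝ}
    (hpq : p ≤ q) (hX : Icc p q ⊆ X) (hc : ∀ t ∈ Ioo p q, c ≤ ENNReal.ofReal (h t)) :
    c * edist (u p) (u q) ≤
      ∫⁻ x in Ioo p q, slopeIn X u x ∂(volume.withDensity fun t => ENNReal.ofReal (h t)) := by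
  obtain ⟨w, hw, huw⟩ := hu.extend_real
  have hae : ∀ᵐ x, x ∈ Ioo p q → ‖deriv w x‖ₑ ≤ slopeIn X u x := by
    filter_upwards [hw.ae_differentiableAt_real] with x hx hxI
    have hXn : X ∈ 𝓝 x := mem_of_superset (isOpen_Ioo.mem_nhds hxI) (Ioo_subset_Icc_self.trans hX)
    rw [slopeIn_congr huw (mem_of_mem_nhds hXn), slopeIn_eq_enorm_deriv hXn hx.hasDerivAt]
  have hint : edist (u p) (u q) ≤ ∫⁻ x in Ioo p q, ‖deriv w x‖ₑ := by
    have hac : AbsolutelyContinuousOnInterval w p q :=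
      (hw.lipschitzOnWith (s := uIcc p q)).absolutelyContinuousOnInterval
    rw [huw (hX (left_mem_Icc.2 hpq)), huw (hX (right_mem_Icc.2 hpq)), edist_comm,
      edist_eq_enorm_sub, ← hac.integral_deriv_eq_sub, intervalIntegral.integral_of_le hpq,
      integral_Ioc_eq_integral_Ioo]
    exact enorm_integral_le_lintegral_enorm _
  have hac : (volume.withDensity fun t => ENNReal.ofReal (h t)) ≪ (volume : Measure ℝ) :=
    withDensity_absolutelyContinuous _ _
  calc c * edist (u p) (u q) ≤ c * ∫⁻ x in Ioo p q, ‖deriv w x‖ₑ := by gcongr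
    _ = ∫⁻ x in Ioo p q, c * ‖deriv w x‖ₑ :=
        (lintegral_const_mul _ (measurable_deriv w).enorm).symm
    _ ≤ ∫⁻ x in Ioo p q, ENNReal.ofReal (h x) * ‖deriv w x‖ₑ :=
        setLIntegral_mono' measurableSet_Ioo fun x hx => by gcongr; exact hc x hx
    _ = ∫⁻ x in Ioo p q, ‖deriv w x‖ₑ ∂(volume.withDensity fun t => ENNReal.ofReal (h t)) :=
        (setLIntegral_withDensity_eq_setLIntegral_mul _ hh.ennreal_ofReal
          (measurable_deriv w).enorm measurableSet_Ioo).symm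
    _ ≤ _ := by
        refine lintegral_mono_ae ?_
        exact (ae_restrict_iff' measurableSet_Ioo).2 (hac.ae_le hae)

theorem TendstoIndicatorL1.eventually_exists {X E A : Set ℝ} {m : Measure ℝ} {u : ℕ → ℝ → ℝ}
    (hu : TendstoIndicatorL1 X m u E) (hA : MeasurableSet A) (hAX : A ⊆ X) (hmA : m A ≠ 0)
    {η : ℝ≥0∞} (hη : 0 < η) :
    ∀ᶠ n in atTop, ∃ y ∈ A, edist (u n y) (E.indicator (fun _ => (1 : ℝ)) y) < η := by
  have hpos : 0 < η * m A := ENNReal.mul_pos hη.ne' hmA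
  filter_upwards [hu.eventually_lt_const hpos] with n hn
  by_contra! hcon
  refine hn.not_ge ?_
  calc η * m A = ∫⁻ _ in A, η ∂m := by simp
    _ ≤ ∫⁻ x in A, edist (u n x) (E.indicator (fun _ => (1 : ℝ)) x) ∂m :=
        setLIntegral_mono' hA hcon
    _ ≤ _ := lintegral_mono_set hAX

/-- By Chebyshev, `u n` is eventually within `η / 2` of 1 at some point of `E` and within `η / 2` of
0 at some point off `E`, so it varies by at least `1 - η` in between. -/
theorem eventually_mul_le_lintegral_slopeIn {X E : Set ℝ} {h : ℝ → ℝ} (hh : Measurable h)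
    {u : ℕ → ℝ → ℝ} (hL : ∀ n, ∃ C, LipschitzOnWith C (u n) X)
    (hu : TendstoIndicatorL1 X (volume.withDensity fun t => ENNReal.ofReal (h t)) u E)
    (hE : MeasurableSet E) {p q : ℝ} (hX : Ioo p q ⊆ X) {c : ℝ≥0∞}
    (hc : ∀ t ∈ Ioo p q, c ≤ ENNReal.ofReal (h t))
    (h1 : volume.withDensity (fun t => ENNReal.ofReal (h t)) (Ioo p q ∩ E) ≠ 0)
    (h2 : volume.withDensity (fun t => ENNReal.ofReal (h t)) (Ioo p q \ E) ≠ 0)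
    {η : ℝ} (hη : 0 < η) :
    ∀ᶠ n in atTop, c * ENNReal.ofReal (1 - η) ≤
      ∫⁻ x in Ioo p q, slopeIn X (u n) x ∂(volume.withDensity fun t => ENNReal.ofReal (h t)) := by
  have hη2 : (0 : ℝ≥0∞) < ENNReal.ofReal (η / 2) := by simpa using hη
  filter_upwards [hu.eventually_exists (measurableSet_Ioo.inter hE) (inter_subset_left.trans hX) h1 hη2,
    hu.eventually_exists (measurableSet_Ioo.diff hE) (sdiff_subset.trans hX) h2 hη2] with n hy hz
  obtain ⟨y, ⟨hyI, hyE⟩, hy⟩ := hy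
  obtain ⟨z, ⟨hzI, hzE⟩, hz⟩ := hz
  rw [indicator_of_mem hyE, edist_dist, ENNReal.ofReal_lt_ofReal_iff (by linarith),
    Real.dist_eq, abs_lt] at hy
  rw [indicator_of_notMem hzE, edist_dist, ENNReal.ofReal_lt_ofReal_iff (by linarith),
    Real.dist_eq, abs_lt] at hz
  obtain ⟨C, hC⟩ := hL n
  have key : ∀ a ∈ Ioo p q, ∀ b ∈ Ioo p q, a ≤ b → c * edist (u n a) (u n b) ≤
      ∫⁻ x in Ioo p q, slopeIn X (u n) x ∂(volume.withDensity fun t => ENNReal.ofReal (h t)) := by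
    intro a ha b hb hab
    have hsub : Icc a b ⊆ Ioo p q := Icc_subset_Ioo ha.1 hb.2
    refine (mul_edist_le_lintegral_slopeIn hC hh hab (hsub.trans hX)
      fun t ht => hc t (hsub (Ioo_subset_Icc_self ht))).trans ?_
    exact lintegral_mono_set (Ioo_subset_Icc_self.trans hsub)
  have hd : ENNReal.ofReal (1 - η) ≤ edist (u n y) (u n z) := by
    rw [edist_dist, Real.dist_eq]
    exact ENNReal.ofReal_le_ofReal ((by linarith [hy.1, hz.2] : 1 - η ≤ u n y - u n z).trans
      (le_abs_self _))
  rcases le_total y z with hyz | hyz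
  · exact (by gcongr : _ ≤ _).trans (key y hyI z hzI hyz)
  · rw [edist_comm] at hd
    exact (by gcongr : _ ≤ _).trans (key z hzI y hyI hyz)

/-- The points of `I` near which both `E` and its complement have positive measure. -/
def essBoundary (m : Measure ℝ) (I E : Set ℝ) : Set ℝ :=
  {x | x ∈ I ∧ ∀ r > 0, m (Ioo (x - r) (x + r) ∩ E) ≠ 0 ∧ m (Ioo (x - r) (x + r) \ E) ≠ 0}

theorem exists_pairwiseDisjoint_Ioo (F : Finset ℝ) :
    ∀ᶠ r in 𝓝[>] (0 : ℝ), (F : Set ℝ).PairwiseDisjoint fun x => Ioo (x - r) (x + r) := by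
  have : ∀ᶠ r in 𝓝[>] (0 : ℝ), ∀ x ∈ F, ∀ y ∈ F, x ≠ y → 2 * r < |x - y| := by
    rw [Finset.eventually_all]
    intro x _
    rw [Finset.eventually_all]
    intro y _
    by_cases hxy : x = y
    · simp [hxy]
    have : 0 < |x - y| / 2 := half_pos (abs_pos.2 (sub_ne_zero.2 hxy))
    filter_upwards [Ioo_mem_nhdsGT this] with r hr _
    linarith [hr.2]
  filter_upwards [this] with r hr x hx y hy hxy
  rw [Function.onFun, Set.disjoint_left]
  intro t ht ht'
  have := hr x hx y hy hxy
  rw [lt_abs] at this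
  rcases this with h | h <;> linarith [ht.1, ht.2, ht'.1, ht'.2]

/-- Disjoint small intervals around the points of `F` each cost at least `(h x - η) * (1 - η)`; then
`η` tends to 0. -/
theorem sum_le_perimeter {X I E : Set ℝ} {h : ℝ → ℝ} (hh : Measurable h) (hIo : IsOpen I)
    (hIX : I ⊆ X) (hcont : ContinuousOn h I) (hE : MeasurableSet E) (F : Finset ℝ)
    (hF : (F : Set ℝ) ⊆ essBoundary (volume.withDensity fun t => ENNReal.ofReal (h t)) I E) :
    ∑ x ∈ F, ENNReal.ofReal (h x)
      ≤ perimeter X (volume.withDensity fun t => ENNReal.ofReal (h t)) E := by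
  refine le_iInf fun u => le_iInf fun hL => le_iInf fun hu => ?_
  have hlim : Tendsto (fun η : ℝ => ∑ x ∈ F, ENNReal.ofReal (h x - η) * ENNReal.ofReal (1 - η))
      (𝓝[>] 0) (𝓝 (∑ x ∈ F, ENNReal.ofReal (h x))) := by
    refine tendsto_finsetSum _ fun x _ => ?_
    have h1 : Tendsto (fun η : ℝ => ENNReal.ofReal (h x - η)) (𝓝[>] 0) (𝓝 (ENNReal.ofReal (h x))) := by
      refine ENNReal.tendsto_ofReal ((Continuous.tendsto' (by fun_prop) _ _ (by simp)).mono_left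
        nhdsWithin_le_nhds)
    have h2 : Tendsto (fun η : ℝ => ENNReal.ofReal (1 - η)) (𝓝[>] 0) (𝓝 1) := by
      rw [← ENNReal.ofReal_one]
      refine ENNReal.tendsto_ofReal ((Continuous.tendsto' (by fun_prop) _ _ (by simp)).mono_left
        nhdsWithin_le_nhds)
    simpa using ENNReal.Tendsto.mul h1 (Or.inr (by simp)) h2 (Or.inr (by simp))
  refine le_of_tendsto hlim ?_
  filter_upwards [self_mem_nhdsWithin] with η hη
  rw [mem_Ioi] at hη
  have hloc : ∀ᶠ r in 𝓝[>] (0 : ℝ), ∀ x ∈ F, ∀ t ∈ Ioo (x - r) (x + r), t ∈ I ∧ h x - η ≤ h t := by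
    rw [Finset.eventually_all]
    intro x hx
    have hxI : x ∈ I := (hF hx).1
    have hev : ∀ᶠ t in 𝓝 x, t ∈ I ∧ h x - η ≤ h t :=
      Filter.Eventually.and (hIo.mem_nhds hxI) ((hcont.continuousAt (hIo.mem_nhds hxI)).eventually_const_le
        (by linarith))
    obtain ⟨δ, hδ, hball⟩ := Metric.eventually_nhds_iff.1 hev
    filter_upwards [Ioo_mem_nhdsGT hδ] with r hr t ht
    refine hball ?_
    rw [Real.dist_eq, abs_lt]
    constructor <;> linarith [ht.1, ht.2, hr.2]
  obtain ⟨r, ⟨hr1, hr2⟩, hr0⟩ :=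
    ((hloc.and (exists_pairwiseDisjoint_Ioo F)).and self_mem_nhdsWithin).exists
  refine le_liminf_of_le (by isBoundedDefault) ?_
  have hev : ∀ᶠ n in atTop, ∀ x ∈ F, ENNReal.ofReal (h x - η) * ENNReal.ofReal (1 - η) ≤
      ∫⁻ t in Ioo (x - r) (x + r), slopeIn X (u n) t
        ∂(volume.withDensity fun t => ENNReal.ofReal (h t)) := by
    rw [Finset.eventually_all]
    intro x hx
    exact eventually_mul_le_lintegral_slopeIn hh hL hu hE (fun t ht => hIX (hr1 x hx t ht).1)
      (fun t ht => ENNReal.ofReal_le_ofReal (hr1 x hx t ht).2) ((hF hx).2 r hr0).1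
      ((hF hx).2 r hr0).2 hη
  filter_upwards [hev] with n hn
  refine (Finset.sum_le_sum hn).trans ?_
  rw [← lintegral_biUnion_finset hr2 fun _ _ => measurableSet_Ioo]
  exact lintegral_mono_set (iUnion₂_subset fun x hx t ht => hIX (hr1 x hx t ht).1)

/-! ### Sets of finite perimeter on the line -/

/-- The measure on the line with density `h`. -/
abbrev densityMeasure (h : ℝ → ℝ) : Measure ℝ := volume.withDensity fun t => ENNReal.ofReal (h t)

/-- `h` is a probability density that is carried by an open interval `I ⊆ X`, and it is continuous
and positive there. -/
structure IsRegularDensity (X I : Set ℝ) (h : ℝ → ℝ) : Prop where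
  measurable : Measurable h
  nonneg : ∀ t, 0 ≤ h t
  isOpen : IsOpen I
  ordConnected : I.OrdConnected
  subset : I ⊆ X
  continuousOn : ContinuousOn h I
  pos : ∀ t ∈ I, 0 < h t
  isProbabilityMeasure : IsProbabilityMeasure (densityMeasure h)
  compl_null : densityMeasure h Iᶜ = 0

theorem densityMeasure_absolutelyContinuous (h : ℝ → ℝ) : densityMeasure h ≪ volume :=
  withDensity_absolutelyContinuous _ _

theorem densityMeasure_countable (h : ℝ → ℝ) {s : Set ℝ} (hs : s.Countable) :
    densityMeasure h s = 0 :=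
  densityMeasure_absolutelyContinuous h (hs.measure_zero _)

namespace IsRegularDensity

variable {X I : Set ℝ} {h : ℝ → ℝ}

theorem measure_ne_zero (H : IsRegularDensity X I h) {V : Set ℝ} (hV : IsOpen V)
    (hne : V.Nonempty) (hVI : V ⊆ I) : densityMeasure h V ≠ 0 := by
  rw [densityMeasure, withDensity_apply _ hV.measurableSet]
  refine ((setLIntegral_pos_iff H.measurable.ennreal_ofReal).2 ?_).ne'
  refine (hV.measure_pos volume hne).trans_le (measure_mono fun x hx => ⟨?_, hx⟩)
  simpa using H.pos x (hVI hx)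

end IsRegularDensity

/-- The points of `I` near which `E` has full measure. -/
def essInterior (m : Measure ℝ) (I E : Set ℝ) : Set ℝ :=
  {x | x ∈ I ∧ ∃ r > 0, m (Ioo (x - r) (x + r) \ E) = 0}

/-! ### Splitting `I` into the essential interiors of `E` and of its complement and the essential
boundary. -/

section EssInterior

variable {m : Measure ℝ} {I E : Set ℝ}

theorem essInterior_subset : essInterior m I E ⊆ I := fun _ hx => hx.1

theorem isOpen_essInterior (hI : IsOpen I) : IsOpen (essInterior m I E) := by
  rw [isOpen_iff_mem_nhds]
  rintro x ⟨hxI, r, hr, h0⟩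
  filter_upwards [hI.mem_nhds hxI, Ioo_mem_nhds (by linarith : x - r / 2 < x)
    (by linarith : x < x + r / 2)] with y hy hyr
  refine ⟨hy, r / 2, by positivity, measure_mono_null (sdiff_subset_sdiff_left ?_) h0⟩
  exact Ioo_subset_Ioo (by linarith [hyr.1]) (by linarith [hyr.2])

theorem measure_essInterior_diff : m (essInterior m I E \ E) = 0 := by
  refine measure_null_of_locally_null _ fun x hx => ?_
  obtain ⟨⟨-, r, hr, h0⟩, -⟩ := hx
  refine ⟨Ioo (x - r) (x + r) \ E, ?_, h0⟩
  refine mem_of_superset (inter_mem_nhdsWithin _ (Ioo_mem_nhds (by linarith : x - r < x)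
    (by linarith : x < x + r))) ?_
  exact fun y hy => ⟨hy.2, hy.1.2⟩

theorem measure_inter_essInterior_compl : m (E ∩ essInterior m I Eᶜ) = 0 := by
  refine measure_mono_null ?_ (measure_essInterior_diff (m := m) (I := I) (E := Eᶜ))
  exact fun x hx => ⟨hx.2, fun h => h hx.1⟩

theorem mem_essBoundary_iff {x : ℝ} : x ∈ essBoundary m I E ↔
    x ∈ I ∧ x ∉ essInterior m I E ∧ x ∉ essInterior m I Eᶜ := by
  have hc : ∀ r, Ioo (x - r) (x + r) \ Eᶜ = Ioo (x - r) (x + r) ∩ E := fun r => by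
    rw [sdiff_compl]
  simp only [essBoundary, essInterior, mem_ofPred_eq, hc]
  constructor
  · rintro ⟨hx, h⟩
    exact ⟨hx, fun ⟨_, r, hr, h0⟩ => (h r hr).2 h0, fun ⟨_, r, hr, h0⟩ => (h r hr).1 h0⟩
  · rintro ⟨hx, h1, h2⟩
    exact ⟨hx, fun r hr => ⟨fun h0 => h2 ⟨hx, r, hr, h0⟩, fun h0 => h1 ⟨hx, r, hr, h0⟩⟩⟩

end EssInterior

/-- `C` is a connected component of `U`. -/
def IsComponent (U C : Set ℝ) : Prop := ∃ x ∈ U, C = connectedComponentIn U x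

/-! ### Connected components of open subsets of the line and their ends. -/

section Component

variable {U C : Set ℝ}

theorem IsComponent.subset (hC : IsComponent U C) : C ⊆ U := by
  obtain ⟨x, -, rfl⟩ := hC; exact connectedComponentIn_subset U x

theorem IsComponent.nonempty (hC : IsComponent U C) : C.Nonempty := by
  obtain ⟨x, hx, rfl⟩ := hC; exact ⟨x, mem_connectedComponentIn hx⟩

theorem IsComponent.ordConnected (hC : IsComponent U C) : C.OrdConnected := by
  obtain ⟨x, -, rfl⟩ := hC; exact isPreconnected_connectedComponentIn.ordConnected

theorem IsComponent.isOpen (hU : IsOpen U) (hC : IsComponent U C) : IsOpen C := by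
  obtain ⟨x, -, rfl⟩ := hC; exact hU.connectedComponentIn

theorem IsComponent.eq_of_mem {C' : Set ℝ} (hC : IsComponent U C) (hC' : IsComponent U C') {x : ℝ}
    (hx : x ∈ C) (hx' : x ∈ C') : C = C' := by
  obtain ⟨y, -, rfl⟩ := hC
  obtain ⟨z, -, rfl⟩ := hC'
  rw [connectedComponentIn_eq hx, connectedComponentIn_eq hx']

theorem IsComponent.disjoint {C' : Set ℝ} (hC : IsComponent U C) (hC' : IsComponent U C')
    (hne : C ≠ C') : Disjoint C C' :=
  disjoint_left.2 fun _ hx hx' => hne (hC.eq_of_mem hC' hx hx')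

theorem IsComponent.mem_of_Icc {x y z : ℝ} (hC : IsComponent U C) (hz : z ∈ C)
    (hzxy : z ∈ Icc x y) (hxy : Icc x y ⊆ U) {t : ℝ} (ht : t ∈ Icc x y) : t ∈ C := by
  obtain ⟨w, hw, rfl⟩ := hC
  rw [connectedComponentIn_eq hz]
  exact isPreconnected_Icc.subset_connectedComponentIn hzxy hxy ht

theorem IsComponent.exists_Ico_subset (hC : IsComponent U C) {r : ℝ} (hr : IsLUB C r) (hrC : r ∉ C) :
    ∃ a ∈ C, a < r ∧ Ico a r ⊆ C := by
  obtain ⟨a, ha⟩ := hC.nonempty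
  refine ⟨a, ha, lt_of_le_of_ne (hr.1 ha) fun h => hrC (h ▸ ha), fun t ht => ?_⟩
  obtain ⟨b, hb, htb⟩ := (lt_isLUB_iff hr).1 ht.2
  exact hC.ordConnected.out ha hb ⟨ht.1, htb.le⟩

theorem IsComponent.exists_Ioc_subset (hC : IsComponent U C) {r : ℝ} (hr : IsGLB C r) (hrC : r ∉ C) :
    ∃ a ∈ C, r < a ∧ Ioc r a ⊆ C := by
  obtain ⟨a, ha⟩ := hC.nonempty
  refine ⟨a, ha, lt_of_le_of_ne (hr.1 ha) fun h => hrC (h ▸ ha), fun t ht => ?_⟩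
  obtain ⟨b, hb, htb⟩ := (isGLB_lt_iff hr).1 ht.1
  exact hC.ordConnected.out hb ha ⟨htb.le, ht.2⟩

/-- If the end were in `U`, a short interval closed at `r` would lie in `U` and meet `C`, so `r`
would belong to the open set `C`. -/
theorem IsComponent.isLUB_notMem (hU : IsOpen U) (hC : IsComponent U C) {r : ℝ} (hr : IsLUB C r) :
    r ∉ U := by
  have hrC : r ∉ C := fun h => by
    obtain ⟨b, hb, hbC⟩ := (mem_nhdsGE_iff_exists_Ico_subset).1
      (mem_nhdsWithin_of_mem_nhds ((hC.isOpen hU).mem_nhds h))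
    have h1 : (r + b) / 2 ∈ C := hbC ⟨by linarith [mem_Ioi.1 hb], by linarith [mem_Ioi.1 hb]⟩
    linarith [hr.1 h1, mem_Ioi.1 hb]
  intro hrU
  obtain ⟨a, ha, har, hsub⟩ := hC.exists_Ico_subset hr hrC
  refine hrC (hC.mem_of_Icc ha (left_mem_Icc.2 har.le) ?_ (right_mem_Icc.2 har.le))
  intro t ht
  rcases ht.2.eq_or_lt with rfl | h
  · exact hrU
  · exact hC.subset (hsub ⟨ht.1, h⟩)

theorem IsComponent.isGLB_notMem (hU : IsOpen U) (hC : IsComponent U C) {r : ℝ} (hr : IsGLB C r) :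
    r ∉ U := by
  have hrC : r ∉ C := fun h => by
    obtain ⟨b, hb, hbC⟩ := (mem_nhdsLE_iff_exists_Ioc_subset).1
      (mem_nhdsWithin_of_mem_nhds ((hC.isOpen hU).mem_nhds h))
    have h1 : (r + b) / 2 ∈ C := hbC ⟨by linarith [mem_Iio.1 hb], by linarith [mem_Iio.1 hb]⟩
    linarith [hr.1 h1, mem_Iio.1 hb]
  intro hrU
  obtain ⟨a, ha, har, hsub⟩ := hC.exists_Ioc_subset hr hrC
  refine hrC (hC.mem_of_Icc ha (right_mem_Icc.2 har.le) ?_ (left_mem_Icc.2 har.le))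
  intro t ht
  rcases ht.1.eq_or_lt with rfl | h
  · exact hrU
  · exact hC.subset (hsub ⟨h, ht.2⟩)

/-- Inner regularity: a compact subset of nearly full measure is covered by finitely many of the
open components. -/
theorem exists_finset_components {m : Measure ℝ} [IsFiniteMeasure m] (hU : IsOpen U) {a : ℝ≥0∞}
    (ha : a < m U) : ∃ F : Finset (Set ℝ), (∀ C ∈ F, IsComponent U C) ∧ a < m (⋃ C ∈ F, C) := by
  classical
  obtain ⟨K, hKU, hK, haK⟩ := hU.exists_lt_isCompact ha
  obtain ⟨t, htK, hcov⟩ := hK.elim_nhds_subcover (connectedComponentIn U)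
    fun x hx => hU.connectedComponentIn.mem_nhds (mem_connectedComponentIn (hKU hx))
  refine ⟨t.image (connectedComponentIn U), ?_, haK.trans_le (measure_mono ?_)⟩
  · intro C hC
    obtain ⟨x, hx, rfl⟩ := Finset.mem_image.1 hC
    exact ⟨x, hKU (htK x hx), rfl⟩
  · simpa using hcov

end Component

open Classical in
/-- The value of `h` at the upper end of `C`, or `0` if this end is not in `I`. -/
def upperCost (I : Set ℝ) (h : ℝ → ℝ) (C : Set ℝ) : ℝ≥0∞ :=
  if BddAbove C ∧ sSup C ∈ I then ENNReal.ofReal (h (sSup C)) else 0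

open Classical in
/-- The value of `h` at the lower end of `C`, or `0` if this end is not in `I`. -/
def lowerCost (I : Set ℝ) (h : ℝ → ℝ) (C : Set ℝ) : ℝ≥0∞ :=
  if BddBelow C ∧ sInf C ∈ I then ENNReal.ofReal (h (sInf C)) else 0

namespace IsRegularDensity

variable {X I : Set ℝ} {h : ℝ → ℝ}

theorem continuousAt (H : IsRegularDensity X I h) {x : ℝ} (hx : x ∈ I) : ContinuousAt h x :=
  H.continuousOn.continuousAt (H.isOpen.mem_nhds hx)

/-- A point of `I` above `C` would place the supremum of `C` between two points of the interval `I`.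
-/
theorem measure_upperBounds (H : IsRegularDensity X I h) {C : Set ℝ} (hne : C.Nonempty)
    (hCI : C ⊆ I) (hc : ¬(BddAbove C ∧ sSup C ∈ I)) : densityMeasure h (upperBounds C) = 0 := by
  suffices hsub : upperBounds C ⊆ Iᶜ from measure_mono_null hsub H.compl_null
  intro y hy hyI
  obtain ⟨x, hx⟩ := hne
  exact hc ⟨⟨y, hy⟩, H.ordConnected.out (hCI hx) hyI
    ⟨le_csSup ⟨y, hy⟩ hx, csSup_le ⟨x, hx⟩ hy⟩⟩

theorem measure_lowerBounds (H : IsRegularDensity X I h) {C : Set ℝ} (hne : C.Nonempty)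
    (hCI : C ⊆ I) (hc : ¬(BddBelow C ∧ sInf C ∈ I)) : densityMeasure h (lowerBounds C) = 0 := by
  suffices hsub : lowerBounds C ⊆ Iᶜ from measure_mono_null hsub H.compl_null
  intro y hy hyI
  obtain ⟨x, hx⟩ := hne
  exact hc ⟨⟨y, hy⟩, H.ordConnected.out hyI (hCI hx)
    ⟨le_csInf ⟨x, hx⟩ hy, csInf_le ⟨y, hy⟩ hx⟩⟩

theorem upperCost_le (H : IsRegularDensity X I h) {C C' : Set ℝ} (hne : C.Nonempty) (hCI : C ⊆ I)
    (hub : upperBounds C' = upperBounds C) : UpperCostLE (densityMeasure h) C' (upperCost I h C) := by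
  unfold upperCost
  split_ifs with hc
  · refine upperCostLE_of_isLUB le_rfl ?_ (H.continuousAt hc.2)
    rw [IsLUB, hub]
    exact isLUB_csSup hne hc.1
  · exact upperCostLE_of_null (by rw [hub]; exact H.measure_upperBounds hne hCI hc)

/-- Allowing any `C'` with the same lower bounds lets a component that is extended to the right keep
its lower cost. -/
theorem lowerCost_le (H : IsRegularDensity X I h) {C C' : Set ℝ} (hne : C.Nonempty) (hCI : C ⊆ I)
    (hlb : lowerBounds C' = lowerBounds C) : LowerCostLE (densityMeasure h) C' (lowerCost I h C) := by
  unfold lowerCost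
  split_ifs with hc
  · refine lowerCostLE_of_isGLB le_rfl ?_ (H.continuousAt hc.2)
    rw [IsGLB, hlb]
    exact isGLB_csInf hne hc.1
  · exact lowerCostLE_of_null (by rw [hlb]; exact H.measure_lowerBounds hne hCI hc)

variable {E : Set ℝ}

theorem tsum_le_perimeter (H : IsRegularDensity X I h) (hE : MeasurableSet E) :
    ∑' x : essBoundary (densityMeasure h) I E, ENNReal.ofReal (h x)
      ≤ perimeter X (densityMeasure h) E := by
  classical
  rw [ENNReal.tsum_eq_iSup_sum]
  refine iSup_le fun F => ?_
  have := sum_le_perimeter H.measurable H.isOpen H.subset H.continuousOn hE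
    (F.map (Function.Embedding.subtype _)) (by
      intro x hx
      simp only [Finset.coe_map, mem_image] at hx
      obtain ⟨y, -, rfl⟩ := hx
      exact y.2)
  simpa using this

theorem finite_essBoundary_le (H : IsRegularDensity X I h) (hE : MeasurableSet E)
    (hP : perimeter X (densityMeasure h) E ≠ ⊤) {c : ℝ} (hc : 0 < c) :
    {x | x ∈ essBoundary (densityMeasure h) I E ∧ c ≤ h x}.Finite := by
  have hfin := ENNReal.finite_const_le_of_tsum_ne_top
    ((H.tsum_le_perimeter hE).trans_lt (lt_top_iff_ne_top.2 hP)).ne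
    (ε := ENNReal.ofReal c) (by simpa using hc)
  refine (hfin.image Subtype.val).subset ?_
  rintro x ⟨hx, hcx⟩
  exact ⟨⟨x, hx⟩, ENNReal.ofReal_le_ofReal hcx, rfl⟩

/-- A finite sum has only finitely many terms above each positive threshold, and `h` is positive on
`I`. -/
theorem countable_essBoundary (H : IsRegularDensity X I h) (hE : MeasurableSet E)
    (hP : perimeter X (densityMeasure h) E ≠ ⊤) :
    (essBoundary (densityMeasure h) I E).Countable := by
  have : essBoundary (densityMeasure h) I E
      ⊆ ⋃ n : ℕ, {x | x ∈ essBoundary (densityMeasure h) I E ∧ 1 / ((n : ℝ) + 1) ≤ h x} := by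
    intro x hx
    obtain ⟨n, hn⟩ := exists_nat_one_div_lt (H.pos x hx.1)
    exact mem_iUnion.2 ⟨n, hx, hn.le⟩
  exact (countable_iUnion fun n =>
    (H.finite_essBoundary_le hE hP (by positivity)).countable).mono this

/-- What `E` has outside its essential interior lies outside `I`, in the countable boundary, or in
the essential interior of the complement, where `E` is null. -/
theorem measure_essInterior (H : IsRegularDensity X I h) (hE : MeasurableSet E)
    (hP : perimeter X (densityMeasure h) E ≠ ⊤) :
    densityMeasure h (essInterior (densityMeasure h) I E) = densityMeasure h E := by
  refine measure_congr (eventuallyLE_antisymm_iff.2 ⟨?_, ?_⟩)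
  · exact ae_le_set.2 measure_essInterior_diff
  · refine ae_le_set.2 (measure_mono_null (t := (Iᶜ ∪ essBoundary (densityMeasure h) I E) ∪
      (E ∩ essInterior (densityMeasure h) I Eᶜ)) ?_ (measure_union_null (measure_union_null
        H.compl_null (densityMeasure_countable h (H.countable_essBoundary hE hP)))
        measure_inter_essInterior_compl))
    rintro x ⟨hxE, hxU⟩
    by_cases hxI : x ∈ I
    · by_cases hxU' : x ∈ essInterior (densityMeasure h) I Eᶜ
      · exact Or.inr ⟨hxE, hxU'⟩
      · exact Or.inl (Or.inr (mem_essBoundary_iff.2 ⟨hxI, hxU, hxU'⟩))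
    · exact Or.inl (Or.inl hxI)

theorem notMem_essInterior_compl (H : IsRegularDensity X I h) {r a b : ℝ} (hab : a < b)
    (hsub : Ioo a b ⊆ essInterior (densityMeasure h) I E) (hr : r ∈ Icc a b) :
    r ∉ essInterior (densityMeasure h) I Eᶜ := by
  rintro ⟨hrI, ρ, hρ, h0⟩
  rw [sdiff_compl] at h0
  have hne : (Ioo a b ∩ Ioo (r - ρ) (r + ρ)).Nonempty := by
    rw [Ioo_inter_Ioo, nonempty_Ioo]
    simp only [lt_inf_iff, sup_lt_iff]
    exact ⟨⟨hab, by linarith [hr.2]⟩, by linarith [hr.1], by linarith⟩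
  refine H.measure_ne_zero (isOpen_Ioo.inter isOpen_Ioo) hne
    (fun x hx => (hsub hx.1).1) (measure_mono_null (t := (essInterior (densityMeasure h) I E \ E) ∪
      (Ioo (r - ρ) (r + ρ) ∩ E)) ?_ (measure_union_null measure_essInterior_diff h0))
  intro x hx
  by_cases hxE : x ∈ E
  · exact Or.inr ⟨hx.2, hxE⟩
  · exact Or.inl ⟨hsub hx.1, hxE⟩

theorem isLUB_mem_essBoundary (H : IsRegularDensity X I h) {C : Set ℝ}
    (hC : IsComponent (essInterior (densityMeasure h) I E) C) {r : ℝ} (hr : IsLUB C r)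
    (hrI : r ∈ I) : r ∈ essBoundary (densityMeasure h) I E := by
  have hrU := hC.isLUB_notMem (isOpen_essInterior H.isOpen) hr
  obtain ⟨a, -, har, hsub⟩ := hC.exists_Ico_subset hr fun h => hrU (hC.subset h)
  exact mem_essBoundary_iff.2 ⟨hrI, hrU, H.notMem_essInterior_compl har
    ((Ioo_subset_Ico_self.trans hsub).trans hC.subset) (right_mem_Icc.2 har.le)⟩

theorem isGLB_mem_essBoundary (H : IsRegularDensity X I h) {C : Set ℝ}
    (hC : IsComponent (essInterior (densityMeasure h) I E) C) {r : ℝ} (hr : IsGLB C r)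
    (hrI : r ∈ I) : r ∈ essBoundary (densityMeasure h) I E := by
  have hrU := hC.isGLB_notMem (isOpen_essInterior H.isOpen) hr
  obtain ⟨a, -, har, hsub⟩ := hC.exists_Ioc_subset hr fun h => hrU (hC.subset h)
  exact mem_essBoundary_iff.2 ⟨hrI, hrU, H.notMem_essInterior_compl har
    ((Ioo_subset_Ioc_self.trans hsub).trans hC.subset) (left_mem_Icc.2 har.le)⟩

/-- Two components meeting at `r` would leave only the null set `{r}` uncovered, so `E` would have
full measure near `r` and `r` would be in the essential interior. -/
theorem isLUB_ne_isGLB (H : IsRegularDensity X I h) {C C' : Set ℝ}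
    (hC : IsComponent (essInterior (densityMeasure h) I E) C)
    (hC' : IsComponent (essInterior (densityMeasure h) I E) C') {r : ℝ} (hr : IsLUB C r)
    (hr' : IsGLB C' r) (hrI : r ∈ I) : False := by
  have hrU := hC.isLUB_notMem (isOpen_essInterior H.isOpen) hr
  obtain ⟨a, -, har, hsub⟩ := hC.exists_Ico_subset hr fun h => hrU (hC.subset h)
  obtain ⟨b, -, hrb, hsub'⟩ := hC'.exists_Ioc_subset hr' fun h => hrU (hC'.subset h)
  refine hrU ⟨hrI, min (r - a) (b - r), lt_min (by linarith) (by linarith),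
    measure_mono_null (t := (essInterior (densityMeasure h) I E \ E) ∪ {r}) ?_
      (measure_union_null measure_essInterior_diff
        (densityMeasure_countable h (countable_singleton r)))⟩
  rintro x ⟨⟨hx1, hx2⟩, hxE⟩
  have h1 := min_le_left (r - a) (b - r)
  have h2 := min_le_right (r - a) (b - r)
  rcases lt_trichotomy x r with hlt | rfl | hlt
  · exact Or.inl ⟨hC.subset (hsub ⟨by linarith, hlt⟩), hxE⟩
  · exact Or.inr rfl
  · exact Or.inl ⟨hC'.subset (hsub' ⟨hlt, by linarith⟩), hxE⟩

theorem eq_of_isLUB (H : IsRegularDensity X I h) {C C' : Set ℝ}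
    (hC : IsComponent (essInterior (densityMeasure h) I E) C)
    (hC' : IsComponent (essInterior (densityMeasure h) I E) C') {r : ℝ} (hr : IsLUB C r)
    (hr' : IsLUB C' r) : C = C' := by
  have hrU := hC.isLUB_notMem (isOpen_essInterior H.isOpen) hr
  obtain ⟨a, ha, har, hsub⟩ := hC.exists_Ico_subset hr fun h => hrU (hC.subset h)
  obtain ⟨b, hb, hrb, hsub'⟩ := hC'.exists_Ico_subset hr' fun h => hrU (hC'.subset h)
  exact hC.eq_of_mem hC' (hsub (show max a b ∈ Ico a r from ⟨le_max_left _ _, max_lt har hrb⟩))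
    (hsub' ⟨le_max_right _ _, max_lt har hrb⟩)

theorem eq_of_isGLB (H : IsRegularDensity X I h) {C C' : Set ℝ}
    (hC : IsComponent (essInterior (densityMeasure h) I E) C)
    (hC' : IsComponent (essInterior (densityMeasure h) I E) C') {r : ℝ} (hr : IsGLB C r)
    (hr' : IsGLB C' r) : C = C' := by
  have hrU := hC.isGLB_notMem (isOpen_essInterior H.isOpen) hr
  obtain ⟨a, ha, har, hsub⟩ := hC.exists_Ioc_subset hr fun h => hrU (hC.subset h)
  obtain ⟨b, hb, hrb, hsub'⟩ := hC'.exists_Ioc_subset hr' fun h => hrU (hC'.subset h)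
  exact hC.eq_of_mem hC' (hsub (show min a b ∈ Ioc r a from ⟨lt_min har hrb, min_le_left _ _⟩))
    (hsub' ⟨lt_min har hrb, min_le_right _ _⟩)

/-- Every end that lies in `I` is an essential boundary point, and none is counted twice: an upper
end determines its component, so does a lower end, and no upper end is a lower end. -/
theorem sum_cost_le_perimeter (H : IsRegularDensity X I h) (hE : MeasurableSet E)
    (F : Finset (Set ℝ)) (hF : ∀ C ∈ F, IsComponent (essInterior (densityMeasure h) I E) C) :
    ∑ C ∈ F, (upperCost I h C + lowerCost I h C) ≤ perimeter X (densityMeasure h) E := by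
  classical
  set Fu := F.filter fun C => BddAbove C ∧ sSup C ∈ I with hFu
  set Fl := F.filter fun C => BddBelow C ∧ sInf C ∈ I with hFl
  have hu : ∀ C ∈ Fu, IsComponent (essInterior (densityMeasure h) I E) C ∧ IsLUB C (sSup C) ∧
      sSup C ∈ I := fun C hC => by
    rw [hFu, Finset.mem_filter] at hC
    exact ⟨hF C hC.1, isLUB_csSup (hF C hC.1).nonempty hC.2.1, hC.2.2⟩
  have hl : ∀ C ∈ Fl, IsComponent (essInterior (densityMeasure h) I E) C ∧ IsGLB C (sInf C) ∧
      sInf C ∈ I := fun C hC => by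
    rw [hFl, Finset.mem_filter] at hC
    exact ⟨hF C hC.1, isGLB_csInf (hF C hC.1).nonempty hC.2.1, hC.2.2⟩
  have h1 : ∑ C ∈ F, upperCost I h C = ∑ x ∈ Fu.image sSup, ENNReal.ofReal (h x) := by
    rw [Finset.sum_image]
    · simp only [upperCost, hFu, Finset.sum_filter]
    · intro C hC C' hC' heq
      exact H.eq_of_isLUB (hu C hC).1 (hu C' hC').1 (hu C hC).2.1 (heq ▸ (hu C' hC').2.1)
  have h2 : ∑ C ∈ F, lowerCost I h C = ∑ x ∈ Fl.image sInf, ENNReal.ofReal (h x) := by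
    rw [Finset.sum_image]
    · simp only [lowerCost, hFl, Finset.sum_filter]
    · intro C hC C' hC' heq
      exact H.eq_of_isGLB (hl C hC).1 (hl C' hC').1 (hl C hC).2.1 (heq ▸ (hl C' hC').2.1)
  rw [Finset.sum_add_distrib, h1, h2, ← Finset.sum_union]
  · refine sum_le_perimeter H.measurable H.isOpen H.subset H.continuousOn hE _ ?_
    intro x hx
    simp only [Finset.coe_union, Finset.coe_image, mem_union, mem_image, Finset.mem_coe] at hx
    rcases hx with ⟨C, hC, rfl⟩ | ⟨C, hC, rfl⟩
    · exact H.isLUB_mem_essBoundary (hu C hC).1 (hu C hC).2.1 (hu C hC).2.2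
    · exact H.isGLB_mem_essBoundary (hl C hC).1 (hl C hC).2.1 (hl C hC).2.2
  · rw [Finset.disjoint_left]
    intro x hx hx'
    obtain ⟨C, hC, rfl⟩ := Finset.mem_image.1 hx
    obtain ⟨C', hC', heq⟩ := Finset.mem_image.1 hx'
    exact H.isLUB_ne_isGLB (hu C hC).1 (hl C' hC').1 (hu C hC).2.1 (heq ▸ (hl C' hC').2.1)
      (hu C hC).2.2

end IsRegularDensity

/-! ### The two profiles agree -/

namespace IsRegularDensity

variable {X I E : Set ℝ} {h : ℝ → ℝ}

theorem integrable (H : IsRegularDensity X I h) : Integrable h := by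
  refine ⟨H.measurable.aestronglyMeasurable, ?_⟩
  rw [hasFiniteIntegral_iff_ofReal (Eventually.of_forall H.nonneg)]
  have := H.isProbabilityMeasure
  have h1 := measure_lt_top (densityMeasure h) univ
  rwa [densityMeasure, withDensity_apply _ MeasurableSet.univ, Measure.restrict_univ] at h1

theorem exists_measure_Icc_eq (H : IsRegularDensity X I h) {r s : ℝ} (hs : 0 ≤ s) {g : ℝ≥0∞}
    (hg : g ≤ densityMeasure h (Icc r (r + s))) :
    ∃ t ∈ Icc 0 s, densityMeasure h (Icc r (r + t)) = g := by
  have hint : ∀ t, 0 ≤ t →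
      densityMeasure h (Icc r (r + t)) = ENNReal.ofReal (∫ y in r..(r + t), h y) := by
    intro t ht
    rw [intervalIntegral.integral_of_le (by linarith), densityMeasure,
      withDensity_apply _ measurableSet_Icc, ← integral_Icc_eq_integral_Ioc,
      ofReal_integral_eq_lintegral_ofReal H.integrable.integrableOn
        (Eventually.of_forall H.nonneg)]
  have hcont : Continuous fun t => ∫ y in r..(r + t), h y :=
    (intervalIntegral.continuous_primitive (fun a b => H.integrable.intervalIntegrable) r).comp
      (by fun_prop : Continuous fun t : ℝ => r + t)
  have hgtop : g ≠ ⊤ := ne_top_of_le_ne_top (by rw [hint s hs]; simp) hg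
  rw [hint s hs] at hg
  obtain ⟨t, ht, heq⟩ := intermediate_value_Icc hs hcont.continuousOn
    (show g.toReal ∈ Icc _ _ from ⟨by simp, by
      refine ENNReal.toReal_le_of_le_ofReal ?_ hg
      exact intervalIntegral.integral_nonneg (by linarith) fun t _ => H.nonneg t⟩)
  refine ⟨t, ht, ?_⟩
  rw [hint t ht.1, ← ENNReal.ofReal_toReal hgtop]
  exact congrArg _ heq

theorem contentLE_component (H : IsRegularDensity X I h) {C : Set ℝ}
    (hC : IsComponent (essInterior (densityMeasure h) I E) C) :
    ContentLE X (densityMeasure h) C (upperCost I h C + lowerCost I h C) :=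
  contentLE_of_ordConnected X hC.ordConnected
    (H.upperCost_le hC.nonempty (hC.subset.trans essInterior_subset) rfl)
    (H.lowerCost_le hC.nonempty (hC.subset.trans essInterior_subset) rfl)

theorem sSup_component_mem (H : IsRegularDensity X I h) {x y : ℝ}
    (hx : x ∈ essInterior (densityMeasure h) I E) (hy : y ∈ I) (hxy : x < y)
    (hyC : y ∉ connectedComponentIn (essInterior (densityMeasure h) I E) x) :
    BddAbove (connectedComponentIn (essInterior (densityMeasure h) I E) x) ∧
      sSup (connectedComponentIn (essInterior (densityMeasure h) I E) x) ∈ I := by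
  set C := connectedComponentIn (essInterior (densityMeasure h) I E) x with hCdef
  have hC : IsComponent (essInterior (densityMeasure h) I E) C := ⟨x, hx, rfl⟩
  have hxC : x ∈ C := mem_connectedComponentIn hx
  have hub : y ∈ upperBounds C := by
    intro z hz
    by_contra! hlt
    exact hyC (hC.ordConnected.out hxC hz ⟨hxy.le, hlt.le⟩)
  exact ⟨⟨y, hub⟩, H.ordConnected.out hx.1 hy ⟨le_csSup ⟨y, hub⟩ hxC, csSup_le ⟨x, hxC⟩ hub⟩⟩

/-- To the right of the upper end of a component there is a gap free of the essential interior. -/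
theorem exists_gap (H : IsRegularDensity X I h) (hE : MeasurableSet E)
    (hP : perimeter X (densityMeasure h) E ≠ ⊤) {C : Set ℝ}
    (hC : IsComponent (essInterior (densityMeasure h) I E) C) {r : ℝ} (hr : IsLUB C r)
    (hrI : r ∈ I) {η : ℝ} (hη : 0 < η) :
    ∃ ρ > 0, ∀ t ∈ Ico r (r + ρ),
      t ∈ I ∧ t ∉ essInterior (densityMeasure h) I E ∧ h t ≤ h r + η := by
  have hpos := H.pos r hrI
  -- By continuity every boundary point close to `r` has `h` at least `h r / 2`. Finite perimeter
  -- allows only finitely many of these, so a neighbourhood of `r` contains no boundary point except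
  -- possibly `r`.
  set Φ := {x | x ∈ essBoundary (densityMeasure h) I E ∧ h r / 2 ≤ h x} with hΦ
  have hfin : Φ.Finite := H.finite_essBoundary_le hE hP (half_pos hpos)
  have hev : ∀ᶠ t in 𝓝 r, t ∈ I ∧ h r / 2 ≤ h t ∧ h t ≤ h r + η ∧ t ∉ Φ \ {r} := by
    refine Filter.Eventually.and (H.isOpen.mem_nhds hrI) (Filter.Eventually.and
      ((H.continuousAt hrI).eventually_const_le (by linarith)) (Filter.Eventually.and
      ((H.continuousAt hrI).eventually_le_const (by linarith)) ?_))
    exact (hfin.subset sdiff_subset).isClosed.isOpen_compl.mem_nhds fun h => h.2 rfl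
  obtain ⟨ρ, hρ, hball⟩ := Metric.eventually_nhds_iff.1 hev
  have hball' : ∀ t ∈ Ico r (r + ρ), t ∈ I ∧ h r / 2 ≤ h t ∧ h t ≤ h r + η ∧ t ∉ Φ \ {r} := by
    intro t ht
    refine hball ?_
    rw [Real.dist_eq, abs_lt]
    constructor <;> linarith [ht.1, ht.2]
  refine ⟨ρ, hρ, fun t ht => ⟨(hball' t ht).1, fun htU => ?_, (hball' t ht).2.2.1⟩⟩
  have hrU := hC.isLUB_notMem (isOpen_essInterior H.isOpen) hr
  set C' := connectedComponentIn (essInterior (densityMeasure h) I E) t with hC'def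
  have hC' : IsComponent (essInterior (densityMeasure h) I E) C' := ⟨t, htU, rfl⟩
  have htC : t ∈ C' := mem_connectedComponentIn htU
  have hlb : r ∈ lowerBounds C' := by
    intro z hz
    by_contra! hlt
    exact hrU (hC'.subset (hC'.ordConnected.out hz htC ⟨hlt.le, ht.1⟩))
  have hglb : IsGLB C' (sInf C') := isGLB_csInf ⟨t, htC⟩ ⟨r, hlb⟩
  -- A component reaching into the gap would begin at a boundary point in it, hence at `r` itself,
  -- which is already the upper end of `C`.
  have hl : sInf C' ∈ Ico r (r + ρ) := ⟨hglb.2 hlb, (hglb.1 htC).trans_lt ht.2⟩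
  have hT := H.isGLB_mem_essBoundary hC' hglb (hball' _ hl).1
  have heq : sInf C' = r := by
    by_contra hne
    exact (hball' _ hl).2.2.2 ⟨⟨hT, (hball' _ hl).2.1⟩, hne⟩
  exact H.isLUB_ne_isGLB hC hC' hr (heq ▸ hglb) hrI

/-- The hypothesis for the empty family and for a single component yields two different components;
the upper end of the left one lies between points of `I`. -/
theorem exists_component_sSup_mem (H : IsRegularDensity X I h)
    (hF : ∀ F : Finset (Set ℝ), (∀ C ∈ F, IsComponent (essInterior (densityMeasure h) I E) C) →
      densityMeasure h (⋃ C ∈ F, C) ≠ densityMeasure h (essInterior (densityMeasure h) I E)) :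
    ∃ C, IsComponent (essInterior (densityMeasure h) I E) C ∧ BddAbove C ∧ sSup C ∈ I := by
  set U := essInterior (densityMeasure h) I E with hUdef
  obtain ⟨x, hx⟩ : U.Nonempty := by
    rw [nonempty_iff_ne_empty]
    intro h0
    exact hF ∅ (by simp) (by simp [h0])
  obtain ⟨y, hy, hyx⟩ : ∃ y ∈ U, y ∉ connectedComponentIn U x := by
    by_contra! hall
    refine hF {connectedComponentIn U x} (by simpa using ⟨x, hx, rfl⟩) ?_
    simp only [Finset.mem_singleton, iUnion_iUnion_eq_left]
    rw [(connectedComponentIn_subset U x).antisymm hall]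
  rcases lt_trichotomy x y with hlt | rfl | hlt
  · exact ⟨_, ⟨x, hx, rfl⟩, H.sSup_component_mem hx hy.1 hlt hyx⟩
  · exact absurd (mem_connectedComponentIn hx) hyx
  · refine ⟨_, ⟨y, hy, rfl⟩, H.sSup_component_mem hy hx.1 hlt fun hxy => hyx ?_⟩
    rw [← connectedComponentIn_eq hxy]
    exact mem_connectedComponentIn hy

theorem measurableSet_component (H : IsRegularDensity X I h) {C : Set ℝ}
    (hC : IsComponent (essInterior (densityMeasure h) I E) C) : MeasurableSet C :=
  (hC.isOpen (isOpen_essInterior H.isOpen)).measurableSet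

theorem contentLE_biUnion (H : IsRegularDensity X I h) (F : Finset (Set ℝ))
    (hF : ∀ C ∈ F, IsComponent (essInterior (densityMeasure h) I E) C) :
    ContentLE X (densityMeasure h) (⋃ C ∈ F, C) (∑ C ∈ F, (upperCost I h C + lowerCost I h C)) :=
  ContentLE.biUnion F id _ (fun C hC => H.contentLE_component (hF C hC))
    (fun C hC => H.measurableSet_component (hF C hC))
    fun C hC C' hC' hne => (hF C hC).disjoint (hF C' hC') hne

theorem contentLE_extended (H : IsRegularDensity X I h) {C : Set ℝ}
    (hC : IsComponent (essInterior (densityMeasure h) I E) C) {r s : ℝ} (hr : IsLUB C r)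
    (hs : 0 ≤ s) (hsI : r + s ∈ I) :
    ContentLE X (densityMeasure h) (C ∪ Icc r (r + s))
      (ENNReal.ofReal (h (r + s)) + lowerCost I h C) := by
  have hord : (C ∪ Icc r (r + s)).OrdConnected := by
    have hlt : ∀ x ∈ C, ∀ z, x ≤ z → z < r → z ∈ C := fun x hx z hxz hz => by
      obtain ⟨b, hb, hzb⟩ := (lt_isLUB_iff hr).1 hz
      exact hC.ordConnected.out hx hb ⟨hxz, hzb.le⟩
    refine ⟨fun x hx y hy z hz => ?_⟩
    have hy' : y ≤ r + s := by
      rcases hy with hy | hy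
      · linarith [hr.1 hy]
      · exact hy.2
    rcases lt_or_ge z r with hzr | hzr
    · rcases hx with hx | hx
      · exact Or.inl (hlt x hx z hz.1 hzr)
      · linarith [hx.1, hz.1]
    · exact Or.inr ⟨hzr, hz.2.trans hy'⟩
  refine contentLE_of_ordConnected X hord ?_
    (H.lowerCost_le hC.nonempty (hC.subset.trans essInterior_subset) ?_)
  · refine upperCostLE_of_isLUB le_rfl ⟨?_, fun y hy => ?_⟩ (H.continuousAt hsI)
    · rintro x (hx | hx)
      · linarith [hr.1 hx]
      · exact hx.2
    · exact hy (Or.inr (right_mem_Icc.2 (by linarith)))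
  · obtain ⟨a, ha⟩ := hC.nonempty
    refine Subset.antisymm (lowerBounds_mono_set subset_union_left) fun y hy => ?_
    rintro x (hx | hx)
    · exact hy hx
    · exact (hy ha).trans ((hr.1 ha).trans hx.1)

/-- A set of finite perimeter can be replaced by a set of the same measure and no larger Minkowski
content, up to a small error. -/
theorem exists_contentLE (H : IsRegularDensity X I h) (hE : MeasurableSet E)
    (hP : perimeter X (densityMeasure h) E ≠ ⊤) {η : ℝ} (hη : 0 < η) :
    ∃ E' ⊆ X, MeasurableSet E' ∧ densityMeasure h E' = densityMeasure h E ∧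
      ContentLE X (densityMeasure h) E'
        (perimeter X (densityMeasure h) E + ENNReal.ofReal η) := by
  classical
  have := H.isProbabilityMeasure
  rw [← H.measure_essInterior hE hP]
  set U := essInterior (densityMeasure h) I E with hUdef
  have hmeas : ∀ F : Finset (Set ℝ), (∀ C ∈ F, IsComponent U C) → MeasurableSet (⋃ C ∈ F, C) :=
    fun F hF => F.measurableSet_biUnion fun C hC => H.measurableSet_component (hF C hC)
  by_cases hex : ∃ F : Finset (Set ℝ), (∀ C ∈ F, IsComponent U C) ∧
      densityMeasure h (⋃ C ∈ F, C) = densityMeasure h U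
  · obtain ⟨F, hF, hFU⟩ := hex
    exact ⟨_, iUnion₂_subset fun C hC => ((hF C hC).subset.trans essInterior_subset).trans H.subset,
      hmeas F hF, hFU, (H.contentLE_biUnion F hF).mono
        ((H.sum_cost_le_perimeter hE F hF).trans le_self_add)⟩
  push Not at hex
  obtain ⟨C, hC, hCb, hCI⟩ := H.exists_component_sSup_mem hex
  have hr : IsLUB C (sSup C) := isLUB_csSup hC.nonempty hCb
  set r := sSup C with hrdef
  obtain ⟨ρ, hρ, hgap⟩ := H.exists_gap hE hP hC hr hCI hη
  have hρ2 : 0 < ρ / 2 := half_pos hρ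
  have hm0 : densityMeasure h (Icc r (r + ρ / 2)) ≠ 0 := by
    refine fun h0 => H.measure_ne_zero isOpen_Ioo (nonempty_Ioo.2 (by linarith : r < r + ρ / 2))
      (fun t ht => (hgap t ⟨ht.1.le, by linarith [ht.2]⟩).1)
      (measure_mono_null Ioo_subset_Icc_self h0)
  have hU0 : densityMeasure h U ≠ 0 := fun h0 => hex ∅ (by simp) (by simp [h0])
  -- The mass outside the components in `F` is at most that of the first half of the gap, so it can
  -- be recovered there. Using only half of the gap keeps `r + s` strictly below `r + ρ`.
  obtain ⟨F, hF, hlt⟩ := exists_finset_components (isOpen_essInterior H.isOpen)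
    (ENNReal.sub_lt_self (measure_ne_top (densityMeasure h) U) hU0 hm0)
  set F' := insert C F with hF'def
  have hF' : ∀ C' ∈ F', IsComponent U C' := by
    intro C' hC'
    rcases Finset.mem_insert.1 hC' with rfl | h
    · exact hC
    · exact hF C' h
  have hle : densityMeasure h (⋃ C ∈ F', C) ≤ densityMeasure h U :=
    measure_mono (iUnion₂_subset fun C hC => (hF' C hC).subset)
  have hgle : densityMeasure h U - densityMeasure h (⋃ C ∈ F', C)
      ≤ densityMeasure h (Icc r (r + ρ / 2)) := by
    refine tsub_le_iff_left.2 (tsub_le_iff_right.1 (hlt.le.trans (measure_mono ?_)))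
    exact biUnion_subset_biUnion_left fun x hx => Finset.mem_insert_of_mem hx
  obtain ⟨s, hs, hseq⟩ := H.exists_measure_Icc_eq hρ2.le hgle
  have hrs : r + s ∈ Ico r (r + ρ) := ⟨by linarith [hs.1], by linarith [hs.2]⟩
  -- `C` may already be in `F`; erasing it keeps the extended component separate from the others.
  have hsplit : (⋃ C ∈ F', C) = C ∪ ⋃ C' ∈ F.erase C, C' := by
    rw [hF'def, ← Finset.insert_erase (Finset.mem_insert_self C F), Finset.erase_insert_eq_erase,
      Finset.set_biUnion_insert]
  have hFe : ∀ C' ∈ F.erase C, IsComponent U C' := fun C' hC' => hF C' (Finset.mem_of_mem_erase hC')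
  have hIccU : Disjoint (Icc r (r + s)) U := disjoint_left.2 fun t ht htU =>
    (hgap t ⟨ht.1, ht.2.trans_lt hrs.2⟩).2.1 htU
  have hdisj : Disjoint (C ∪ Icc r (r + s)) (⋃ C' ∈ F.erase C, C') := by
    rw [disjoint_union_left, disjoint_iUnion₂_right, disjoint_iUnion₂_right]
    exact ⟨fun C' hC' => hC.disjoint (hFe C' hC') (Finset.ne_of_mem_erase hC').symm,
      fun C' hC' => hIccU.mono_right (hFe C' hC').subset⟩
  refine ⟨(C ∪ Icc r (r + s)) ∪ ⋃ C' ∈ F.erase C, C', ?_,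
    ((H.measurableSet_component hC).union measurableSet_Icc).union (hmeas _ hFe), ?_, ?_⟩
  · refine union_subset (union_subset ((hC.subset.trans essInterior_subset).trans H.subset) ?_)
      (iUnion₂_subset fun C' hC' => ((hFe C' hC').subset.trans essInterior_subset).trans H.subset)
    exact fun t ht => H.subset (hgap t ⟨ht.1, ht.2.trans_lt hrs.2⟩).1
  · have : (C ∪ Icc r (r + s)) ∪ ⋃ C' ∈ F.erase C, C' = (⋃ C ∈ F', C) ∪ Icc r (r + s) := by
      rw [hsplit, union_right_comm]
    rw [this, measure_union _ measurableSet_Icc, hseq, add_tsub_cancel_of_le hle]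
    exact (hIccU.mono_right (iUnion₂_subset fun C hC => (hF' C hC).subset)).symm
  · refine ((H.contentLE_extended hC hr hs.1 (hgap _ hrs).1).union (H.contentLE_biUnion _ hFe) hdisj
      (hmeas _ hFe)).mono ?_
    have hup : upperCost I h C = ENNReal.ofReal (h r) := if_pos ⟨hCb, hCI⟩
    have hsum := H.sum_cost_le_perimeter hE F' hF'
    rw [hF'def, ← Finset.insert_erase (Finset.mem_insert_self C F), Finset.erase_insert_eq_erase,
      Finset.sum_insert (Finset.notMem_erase C F), hup] at hsum
    calc _ ≤ (ENNReal.ofReal (h r) + ENNReal.ofReal η + lowerCost I h C)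
            + ∑ C ∈ F.erase C, (upperCost I h C + lowerCost I h C) := by
          gcongr
          rw [← ENNReal.ofReal_add (H.nonneg r) hη.le]
          exact ENNReal.ofReal_le_ofReal (hgap _ hrs).2.2
      _ = (ENNReal.ofReal (h r) + lowerCost I h C
            + ∑ C ∈ F.erase C, (upperCost I h C + lowerCost I h C)) + ENNReal.ofReal η := by ring
      _ ≤ _ := by gcongr

theorem perimeterProfile_eq_contentProfile (H : IsRegularDensity X I h) (v : ℝ) :
    perimeterProfile X (densityMeasure h) v = contentProfile X (densityMeasure h) v := by
  have := H.isProbabilityMeasure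
  refine le_antisymm ?_ ?_
  · refine iInf_mono fun E => iInf_mono fun hEX => iInf_mono fun hE => iInf_mono fun _ => ?_
    exact perimeter_le_outerMinkowskiContent (densityMeasure_absolutelyContinuous h) hEX hE
  · refine le_iInf fun E => le_iInf fun hEX => le_iInf fun hE => le_iInf fun hv => ?_
    by_cases hP : perimeter X (densityMeasure h) E = ⊤
    · simp [hP]
    have hlim : Tendsto (fun η : ℝ => perimeter X (densityMeasure h) E + ENNReal.ofReal η)
        (𝓝[>] 0) (𝓝 (perimeter X (densityMeasure h) E + 0)) := by
      refine tendsto_const_nhds.add ?_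
      rw [← ENNReal.ofReal_zero]
      exact ENNReal.tendsto_ofReal (tendsto_id.mono_left nhdsWithin_le_nhds)
    rw [add_zero] at hlim
    refine ge_of_tendsto hlim ?_
    filter_upwards [self_mem_nhdsWithin] with η hη
    obtain ⟨E', hE'X, hE', hm, hc⟩ := H.exists_contentLE hE hP hη
    exact iInf_le_of_le E' (iInf_le_of_le hE'X (iInf_le_of_le hE' (iInf_le_of_le (hm.trans hv)
      hc.outerMinkowskiContent_le)))

end IsRegularDensity

/-! ### Half-lines in weighted intervals -/

theorem intervalFrom_top (x : ℝ) : intervalFrom x ⊤ = Ici x := by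
  ext t; simp [intervalFrom]

theorem intervalFrom_ofReal (x : ℝ) {d : ℝ} (hd : 0 ≤ d) :
    intervalFrom x (ENNReal.ofReal d) = Icc x (x + d) := by
  ext t
  simp only [intervalFrom, mem_ofPred_eq, mem_Icc, ENNReal.ofReal_le_ofReal_iff hd]
  constructor <;> rintro ⟨h1, h2⟩ <;> constructor <;> linarith

theorem intervalFrom_eq (x : ℝ) (D : ℝ≥0∞) :
    intervalFrom x D = Ici x ∨ ∃ d, 0 ≤ d ∧ intervalFrom x D = Icc x (x + d) := by
  rcases eq_or_ne D ⊤ with rfl | hD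
  · exact Or.inl (intervalFrom_top x)
  · right
    rw [← ENNReal.ofReal_toReal hD]
    exact ⟨D.toReal, ENNReal.toReal_nonneg, intervalFrom_ofReal x ENNReal.toReal_nonneg⟩

theorem measurableSet_intervalFrom (x : ℝ) (D : ℝ≥0∞) : MeasurableSet (intervalFrom x D) := by
  rcases intervalFrom_eq x D with h | ⟨d, -, h⟩ <;> rw [h]
  · exact measurableSet_Ici
  · exact measurableSet_Icc

theorem ordConnected_intervalFrom (x : ℝ) (D : ℝ≥0∞) : (intervalFrom x D).OrdConnected := by
  rcases intervalFrom_eq x D with h | ⟨d, -, h⟩ <;> rw [h]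
  · exact ordConnected_Ici
  · exact ordConnected_Icc

theorem intervalFrom_mono (x : ℝ) {a b : ℝ≥0∞} (hab : a ≤ b) :
    intervalFrom x a ⊆ intervalFrom x b := fun _ ht => ⟨ht.1, ht.2.trans hab⟩

theorem intervalFrom_neg_inter_Iic {s : ℝ} {D : ℝ≥0∞} (hsD : ENNReal.ofReal s ≤ D) :
    intervalFrom (-s) D ∩ Iic 0 = Icc (-s) 0 := by
  ext t
  constructor
  · rintro ⟨h, h'⟩; exact ⟨h.1, h'⟩
  · rintro ⟨h, h'⟩
    exact ⟨⟨h, (ENNReal.ofReal_le_ofReal (by linarith)).trans hsD⟩, h'⟩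

theorem intervalFrom_neg_inter_Ici {s : ℝ} {D : ℝ≥0∞} (hs : 0 ≤ s) (hsD : ENNReal.ofReal s ≤ D) :
    intervalFrom (-s) D ∩ Ici 0 = intervalFrom 0 (D - ENNReal.ofReal s) := by
  ext t
  have key : ∀ ht : 0 ≤ t, ENNReal.ofReal (t - -s) ≤ D ↔
      ENNReal.ofReal (t - 0) ≤ D - ENNReal.ofReal s := fun ht => by
    rw [ENNReal.le_sub_iff_add_le_right ENNReal.ofReal_ne_top hsD, sub_neg_eq_add, sub_zero,
      ENNReal.ofReal_add ht hs]
  constructor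
  · rintro ⟨h, h'⟩
    exact ⟨h', (key h').1 h.2⟩
  · rintro ⟨h, h'⟩
    exact ⟨⟨by linarith, (key h).2 h'⟩, h⟩

theorem mass_mono {L L' : Set ℝ} (f : ℝ → ℝ) (h : L ⊆ L') : mass L f ≤ mass L' f :=
  lintegral_mono_set h

theorem mass_Icc_neg (f : ℝ → ℝ) (s : ℝ) :
    mass (Icc (-s) 0) f = mass (Icc 0 s) fun t => f (-t) := by
  unfold mass
  have h := (Measure.measurePreserving_neg (volume : Measure ℝ)).setLIntegral_comp_preimage_emb
    (MeasurableEquiv.neg ℝ).measurableEmbedding (fun t => ENNReal.ofReal (f t)) (Icc (-s) 0)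
  rw [← h]
  congr 2
  ext t
  simp [and_comm]

theorem mass_intervalFrom_neg (f : ℝ → ℝ) {s : ℝ} {D : ℝ≥0∞} (hs : 0 ≤ s)
    (hsD : ENNReal.ofReal s ≤ D) : mass (intervalFrom (-s) D) f
      = mass (intervalFrom 0 (ENNReal.ofReal s)) (fun t => f (-t))
        + mass (intervalFrom 0 (D - ENNReal.ofReal s)) f := by
  rw [intervalFrom_ofReal 0 hs, zero_add, ← mass_Icc_neg, ← intervalFrom_neg_inter_Iic hsD,
    ← intervalFrom_neg_inter_Ici hs hsD]
  have h1 : mass (intervalFrom (-s) D ∩ Iic 0) f = mass (intervalFrom (-s) D ∩ Iio 0) f := by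
    refine setLIntegral_congr ?_
    exact (ae_eq_refl _).inter Iio_ae_eq_Iic.symm
  rw [h1]
  unfold mass
  rw [← lintegral_inter_add_sdiff _ (intervalFrom (-s) D) measurableSet_Iio]
  congr 3
  ext t
  simp

theorem normalizedMeasure_absolutelyContinuous (L : Set ℝ) (f : ℝ → ℝ) :
    normalizedMeasure L f ≪ volume.restrict L :=
  (withDensity_absolutelyContinuous _ _).smul_left _

theorem normalizedMeasure_apply {L C : Set ℝ} (f : ℝ → ℝ) (hC : MeasurableSet C) (hCL : C ⊆ L) :
    normalizedMeasure L f C = (mass L f)⁻¹ * mass C f := by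
  rw [normalizedMeasure, Measure.smul_apply, withDensity_apply _ hC,
    Measure.restrict_restrict hC, inter_eq_self_of_subset_left hCL]
  rfl

/-- Only an inequality, since the right-hand side is not restricted to `L`; its density is
continuous at 0 even when 0 is an end of `L`, provided that `f` is. -/
theorem normalizedMeasure_le {L : Set ℝ} {f : ℝ → ℝ} (hf : Measurable f) (hL : MeasurableSet L)
    (h0 : mass L f ≠ 0) :
    normalizedMeasure L f ≤ densityMeasure fun t => f t / (mass L f).toReal := by
  by_cases htop : mass L f = ⊤
  · simp only [normalizedMeasure, htop, ENNReal.inv_top, zero_smul]; exact Measure.zero_le _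
  have hpos : 0 < (mass L f).toReal := ENNReal.toReal_pos h0 htop
  have : (fun t => ENNReal.ofReal (f t / (mass L f).toReal))
      = (mass L f)⁻¹ • fun t => ENNReal.ofReal (f t) := by
    ext t
    rw [ENNReal.ofReal_div_of_pos hpos, ENNReal.ofReal_toReal htop, Pi.smul_apply, smul_eq_mul,
      ENNReal.div_eq_inv_mul]
  rw [densityMeasure, this, withDensity_smul _ hf.ennreal_ofReal, normalizedMeasure,
    ← restrict_withDensity hL]
  refine Measure.le_iff.2 fun s _ => ?_
  simp only [Measure.smul_apply, smul_eq_mul]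
  gcongr
  exact Measure.restrict_le_self

theorem isProbabilityMeasure_normalizedMeasure {L : Set ℝ} {f : ℝ → ℝ}
    (h0 : mass L f ≠ 0) (htop : mass L f ≠ ⊤) : IsProbabilityMeasure (normalizedMeasure L f) := by
  refine ⟨?_⟩
  rw [normalizedMeasure, Measure.smul_apply, withDensity_apply _ MeasurableSet.univ,
    Measure.restrict_univ, smul_eq_mul]
  exact ENNReal.inv_mul_cancel h0 htop

theorem densityProfile_le_of_mass_eq {L C : Set ℝ} {f : ℝ → ℝ} {v : ℝ} {p : ℝ≥0∞}
    (h0 : mass L f ≠ 0) (hC : MeasurableSet C) (hCL : C ⊆ L)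
    (hv : mass C f = ENNReal.ofReal v * mass L f)
    (hp : mass L f ≠ ⊤ → ContentLE L (normalizedMeasure L f) C p) :
    densityProfile L f v ≤ p := by
  unfold densityProfile
  rw [if_neg h0]
  split_ifs with htop
  · exact zero_le
  have := isProbabilityMeasure_normalizedMeasure h0 htop
  refine iInf_le_of_le C (iInf_le_of_le hCL (iInf_le_of_le hC (iInf_le_of_le ?_ ?_)))
  · rw [normalizedMeasure_apply f hC hCL, hv, mul_left_comm, ENNReal.inv_mul_cancel h0 htop, mul_one]
  · exact (perimeter_le_outerMinkowskiContent ((normalizedMeasure_absolutelyContinuous L f).trans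
      Measure.absolutelyContinuous_restrict) hCL hC).trans (hp htop).outerMinkowskiContent_le

/-- All of `L` beyond `x` belongs to `C`, so at most one point of `L` is an upper bound of `C`. -/
theorem upperCostLE_normalizedMeasure {L C : Set ℝ} (hL : MeasurableSet L) (f : ℝ → ℝ) {x : ℝ}
    (hx : x ∈ C) (hC : L ∩ Ici x ⊆ C) : UpperCostLE (normalizedMeasure L f) C 0 := by
  refine upperCostLE_of_null (normalizedMeasure_absolutelyContinuous L f ?_)
  rw [Measure.restrict_apply' hL]
  refine Subsingleton.measure_zero (fun y hy z hz => le_antisymm ?_ ?_) _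
  · exact hz.1 (hC ⟨hy.2, hy.1 hx⟩)
  · exact hy.1 (hC ⟨hz.2, hz.1 hx⟩)

theorem lowerCostLE_normalizedMeasure {L C : Set ℝ} (hL : MeasurableSet L) (f : ℝ → ℝ) {x : ℝ}
    (hx : x ∈ C) (hC : L ∩ Iic x ⊆ C) : LowerCostLE (normalizedMeasure L f) C 0 := by
  refine lowerCostLE_of_null (normalizedMeasure_absolutelyContinuous L f ?_)
  rw [Measure.restrict_apply' hL]
  refine Subsingleton.measure_zero (fun y hy z hz => le_antisymm ?_ ?_) _
  · exact hy.1 (hC ⟨hz.2, hz.1 hx⟩)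
  · exact hz.1 (hC ⟨hy.2, hy.1 hx⟩)

theorem mass_intervalFrom_zero (f : ℝ → ℝ) : mass (intervalFrom 0 0) f = 0 := by
  have := intervalFrom_ofReal 0 le_rfl
  rw [ENNReal.ofReal_zero, add_zero, Icc_self] at this
  rw [this, mass, Measure.restrict_singleton]
  simp

/-- The competitor is the part of the interval left of 0. Its lower end is an end of the whole space
and costs nothing; at the cut 0 the normalized density is `(A + B)⁻¹` because `f 0 = 1`. -/
theorem densityProfile_le_of_left_mass {f : ℝ → ℝ} (hf : Measurable f) (hcont : ContinuousAt f 0)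
    (hf0 : f 0 = 1) {s v : ℝ} {D A B : ℝ≥0∞} (hs : 0 ≤ s) (hsD : ENNReal.ofReal s ≤ D)
    (hA : mass (intervalFrom 0 (ENNReal.ofReal s)) (fun t => f (-t)) = A)
    (hB : mass (intervalFrom 0 (D - ENNReal.ofReal s)) f = B) (hA0 : A ≠ 0)
    (hv : A = ENNReal.ofReal v * (A + B)) :
    densityProfile (intervalFrom (-s) D) f v ≤ (A + B)⁻¹ := by
  have hM : mass (intervalFrom (-s) D) f = A + B := by rw [mass_intervalFrom_neg f hs hsD, hA, hB]
  have h0 : mass (intervalFrom (-s) D) f ≠ 0 := by rw [hM]; simp [hA0]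
  have hL := measurableSet_intervalFrom (-s) D
  have hs0 : 0 < s := lt_of_le_of_ne hs fun h => hA0 (by
    rw [← hA, ← h, ENNReal.ofReal_zero, mass_intervalFrom_zero])
  have hC : intervalFrom (-s) D ∩ Iic 0 = Icc (-s) 0 := intervalFrom_neg_inter_Iic hsD
  have h0C : (0 : ℝ) ∈ intervalFrom (-s) D ∩ Iic 0 := by rw [hC]; exact ⟨by linarith, le_rfl⟩
  refine densityProfile_le_of_mass_eq (C := intervalFrom (-s) D ∩ Iic 0) h0
    (hL.inter measurableSet_Iic) inter_subset_left ?_ ?_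
  · rw [hM, ← hv, ← hA, hC, mass_Icc_neg, intervalFrom_ofReal 0 hs, zero_add]
  · intro htop
    have hlow := lowerCostLE_normalizedMeasure hL f h0C Subset.rfl
    have hup := upperCostLE_of_isLUB (C := intervalFrom (-s) D ∩ Iic 0) (r := 0)
      (normalizedMeasure_le hf hL h0) (by rw [hC]; exact isLUB_Icc (by linarith))
      (hcont.div_const _)
    have := contentLE_of_ordConnected (intervalFrom (-s) D)
      ((ordConnected_intervalFrom (-s) D).inter ordConnected_Iic) hup hlow
    rw [add_zero, hf0, hM, one_div, ENNReal.ofReal_inv_of_pos, ENNReal.ofReal_toReal] at this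
    · exact this
    · rwa [← hM]
    · rw [← hM]; exact ENNReal.toReal_pos h0 htop

theorem densityProfile_le_of_right_mass {f : ℝ → ℝ} (hf : Measurable f) (hcont : ContinuousAt f 0)
    (hf0 : f 0 = 1) {s v : ℝ} {D A B : ℝ≥0∞} (hs : 0 ≤ s) (hsD : ENNReal.ofReal s ≤ D)
    (hA : mass (intervalFrom 0 (ENNReal.ofReal s)) (fun t => f (-t)) = A)
    (hB : mass (intervalFrom 0 (D - ENNReal.ofReal s)) f = B) (hA0 : A ≠ 0)
    (hv : B = ENNReal.ofReal v * (A + B)) :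
    densityProfile (intervalFrom (-s) D) f v ≤ (A + B)⁻¹ := by
  have hM : mass (intervalFrom (-s) D) f = A + B := by rw [mass_intervalFrom_neg f hs hsD, hA, hB]
  have h0 : mass (intervalFrom (-s) D) f ≠ 0 := by rw [hM]; simp [hA0]
  have hL := measurableSet_intervalFrom (-s) D
  have hC : intervalFrom (-s) D ∩ Ici 0 = intervalFrom 0 (D - ENNReal.ofReal s) :=
    intervalFrom_neg_inter_Ici hs hsD
  have h0C : (0 : ℝ) ∈ intervalFrom (-s) D ∩ Ici 0 := by rw [hC]; exact ⟨le_rfl, by simp⟩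
  refine densityProfile_le_of_mass_eq (C := intervalFrom (-s) D ∩ Ici 0) h0
    (hL.inter measurableSet_Ici) inter_subset_left ?_ ?_
  · rw [hM, ← hv, ← hB, hC]
  · intro htop
    have hup := upperCostLE_normalizedMeasure hL f h0C Subset.rfl
    have hlow := lowerCostLE_of_isGLB (C := intervalFrom (-s) D ∩ Ici 0) (r := 0)
      (normalizedMeasure_le hf hL h0) ⟨fun y hy => hy.2, fun y hy => hy h0C⟩
      (hcont.div_const _)
    have := contentLE_of_ordConnected (intervalFrom (-s) D)
      ((ordConnected_intervalFrom (-s) D).inter ordConnected_Ici) hup hlow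
    rw [zero_add, hf0, hM, one_div, ENNReal.ofReal_inv_of_pos, ENNReal.ofReal_toReal] at this
    · exact this
    · rwa [← hM]
    · rw [← hM]; exact ENNReal.toReal_pos h0 htop

theorem densityProfile_zero {L : Set ℝ} {f : ℝ → ℝ} (h0 : mass L f ≠ 0) :
    densityProfile L f 0 = 0 := by
  refine le_antisymm (densityProfile_le_of_mass_eq h0 MeasurableSet.empty (empty_subset _) ?_
    fun _ => contentLE_empty _ _) zero_le
  simp [mass]

theorem densityProfile_one {L : Set ℝ} {f : ℝ → ℝ} (hL : MeasurableSet L) (h0 : mass L f ≠ 0) :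
    densityProfile L f 1 = 0 := by
  refine le_antisymm (densityProfile_le_of_mass_eq h0 hL Subset.rfl (by simp) fun _ c _ => ?_)
    zero_le
  exact Eventually.of_forall fun ε => (measure_mono inter_subset_left).trans le_self_add

/-! ### Model densities -/

theorem continuous_sn (δ : ℝ) : Continuous (sn δ) := by
  unfold sn
  split_ifs <;> fun_prop

theorem continuous_cs (δ : ℝ) : Continuous (cs δ) := by
  unfold cs
  split_ifs <;> fun_prop

@[simp] theorem sn_zero (δ : ℝ) : sn δ 0 = 0 := by
  unfold sn; split_ifs <;> simp

@[simp] theorem cs_zero (δ : ℝ) : cs δ 0 = 1 := by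
  unfold cs; split_ifs <;> simp

theorem sn_neg (δ t : ℝ) : sn δ (-t) = -sn δ t := by
  unfold sn; split_ifs <;> simp [neg_div]

theorem cs_neg (δ t : ℝ) : cs δ (-t) = cs δ t := by
  unfold cs; split_ifs <;> simp

theorem one_le_cs {δ : ℝ} (hδ : δ ≤ 0) (t : ℝ) : 1 ≤ cs δ t := by
  unfold cs
  rw [if_neg hδ.not_gt]
  split_ifs
  · exact le_rfl
  · exact Real.one_le_cosh _

/-! ### Truncation of a function to the interval between its roots around 0. -/

section BetweenRoots

variable {f : ℝ → ℝ}

/-- The set on which `betweenRoots f` agrees with `f`. -/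
def rootInterval (f : ℝ → ℝ) : Set ℝ :=
  {t | (∀ ξ ≤ 0, f ξ = 0 → ξ ≤ t) ∧ ∀ ξ > 0, f ξ = 0 → t ≤ ξ}

theorem betweenRoots_eq (f : ℝ → ℝ) : betweenRoots f = (rootInterval f).indicator f := by
  unfold betweenRoots rootInterval lowerRoot upperRoot
  congr 1
  ext t
  simp only [mem_ofPred_eq, sSup_le_iff, le_sInf_iff, forall_mem_image]
  simp

theorem ordConnected_rootInterval (f : ℝ → ℝ) : (rootInterval f).OrdConnected :=
  ⟨fun _ hx _ hy _ hz => ⟨fun ξ h1 h2 => (hx.1 ξ h1 h2).trans hz.1,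
    fun ξ h1 h2 => hz.2.trans (hy.2 ξ h1 h2)⟩⟩

theorem measurable_betweenRoots (hf : Continuous f) : Measurable (betweenRoots f) := by
  rw [betweenRoots_eq]
  exact hf.measurable.indicator (ordConnected_rootInterval f).measurableSet

/-- A negative value at `t` yields a root between 0 and `t`; the truncation forces that root to be
`t`, a contradiction. -/
theorem betweenRoots_nonneg (hf : Continuous f) (h0 : 0 < f 0) (t : ℝ) : 0 ≤ betweenRoots f t := by
  rw [betweenRoots_eq]
  refine indicator_nonneg (fun t ht => ?_) t
  by_contra! hlt
  rcases le_total t 0 with h | h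
  · obtain ⟨ξ, hξ, hξ0⟩ := intermediate_value_Icc h hf.continuousOn ⟨hlt.le, h0.le⟩
    obtain rfl := le_antisymm (ht.1 ξ hξ.2 hξ0) hξ.1
    exact hlt.ne hξ0
  · obtain ⟨ξ, hξ, hξ0⟩ := intermediate_value_Icc' h hf.continuousOn ⟨hlt.le, h0.le⟩
    have hpos : 0 < ξ := lt_of_le_of_ne hξ.1 fun h => h0.ne' (h ▸ hξ0)
    obtain rfl := le_antisymm hξ.2 (ht.2 ξ hpos hξ0)
    exact hlt.ne hξ0

theorem betweenRoots_eventuallyEq (hf : Continuous f) (h0 : 0 < f 0) :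
    betweenRoots f =ᶠ[𝓝 0] f := by
  obtain ⟨ε, hε, hball⟩ := Metric.eventually_nhds_iff.1
    (hf.continuousAt.eventually_const_lt h0 : ∀ᶠ t in 𝓝 0, 0 < f t)
  filter_upwards [Metric.ball_mem_nhds 0 hε] with t ht
  rw [betweenRoots_eq]
  suffices t ∈ rootInterval f from indicator_of_mem this f
  refine ⟨fun ξ hξ hξ0 => ?_, fun ξ hξ hξ0 => ?_⟩
  all_goals
    rw [Metric.mem_ball, Real.dist_eq, sub_zero, abs_lt] at ht
    by_contra! hlt
    refine (hball (y := ξ) ?_).ne' hξ0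
    rw [Real.dist_eq, sub_zero, abs_lt]
    constructor <;> linarith [ht.1, ht.2]

/-- The lower root may be 0 while the upper root may not, so the reflection symmetry requires `f 0 ≠
0`. -/
theorem betweenRoots_comp_neg (h0 : f 0 ≠ 0) (t : ℝ) :
    betweenRoots (fun r => f (-r)) t = betweenRoots f (-t) := by
  have key : t ∈ rootInterval (fun r => f (-r)) ↔ -t ∈ rootInterval f := by
    constructor
    · rintro ⟨h1, h2⟩
      refine ⟨fun ξ hξ hξ0 => ?_, fun ξ hξ hξ0 => ?_⟩
      · have hneg : ξ < 0 := lt_of_le_of_ne hξ fun h => h0 (h ▸ hξ0)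
        linarith [h2 (-ξ) (by linarith) (by simpa using hξ0)]
      · linarith [h1 (-ξ) (by linarith) (by simpa using hξ0)]
    · rintro ⟨h1, h2⟩
      refine ⟨fun ξ hξ hξ0 => ?_, fun ξ hξ hξ0 => ?_⟩
      · have hneg : ξ < 0 := lt_of_le_of_ne hξ fun h => h0 (by simpa [h] using hξ0)
        linarith [h2 (-ξ) (by linarith) hξ0]
      · linarith [h1 (-ξ) (by linarith) hξ0]
  rw [betweenRoots_eq, betweenRoots_eq]
  by_cases h : -t ∈ rootInterval f
  · rw [indicator_of_mem h, indicator_of_mem (key.2 h)]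
  · rw [indicator_of_notMem h, indicator_of_notMem fun h' => h (key.1 h')]

theorem abs_betweenRoots_le (f : ℝ → ℝ) (t : ℝ) : |betweenRoots f t| ≤ |f t| := by
  rw [betweenRoots_eq]
  by_cases h : t ∈ rootInterval f <;> simp [h]

end BetweenRoots

/-- The function whose `(N - 1)`-th power, between its roots around `0`, is the model density. -/
def modelRoot (K N H : ℝ) (t : ℝ) : ℝ :=
  cs (K / (N - 1)) t + H / (N - 1) * sn (K / (N - 1)) t

theorem continuous_modelRoot (K N H : ℝ) : Continuous (modelRoot K N H) :=
  (continuous_cs _).add (continuous_const.mul (continuous_sn _))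

@[simp] theorem modelRoot_zero (K N H : ℝ) : modelRoot K N H 0 = 1 := by simp [modelRoot]

theorem modelRoot_neg (K N H t : ℝ) : modelRoot K N H (-t) = modelRoot K N (-H) t := by
  simp only [modelRoot, sn_neg, cs_neg]; ring

theorem modelDensity_of_one_lt {N : ℝ} (hN : 1 < N) (H K t : ℝ) :
    modelDensity H K N t = betweenRoots (modelRoot K N H) t ^ (N - 1) := by
  rw [modelDensity, if_neg hN.ne']; rfl

/-- The properties of the model densities that enter the comparison argument. -/
structure IsModelDensity (f : ℝ → ℝ) : Prop where
  measurable : Measurable f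
  nonneg : ∀ t, 0 ≤ f t
  continuousAt : ContinuousAt f 0
  apply_zero : f 0 = 1
  intervalIntegrable : ∀ a b, IntervalIntegrable f volume a b

theorem modelDensity_one_eq {K : ℝ} (hK : K ≤ 0) : modelDensity 0 K 1 = fun _ => 1 := by
  ext t
  simp [modelDensity, hK.not_gt]

/-- For `N = 1` only `H = 0` is admitted: any other `H` gives the indicator of a half-line, which
jumps at the cut. -/
theorem isModelDensity_modelDensity {H K N : ℝ} (hN : 1 ≤ N) (hH : N = 1 → K ≤ 0 ∧ H = 0) :
    IsModelDensity (modelDensity H K N) := by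
  rcases hN.eq_or_lt with rfl | hN
  · obtain ⟨hK, rfl⟩ := hH rfl
    rw [modelDensity_one_eq hK]
    exact ⟨measurable_const, fun _ => zero_le_one, continuousAt_const, rfl,
      fun _ _ => intervalIntegrable_const⟩
  have hN1 : 0 < N - 1 := by linarith
  have hc := continuous_modelRoot K N H
  have h0 : 0 < modelRoot K N H 0 := by simp
  have heq : modelDensity H K N = fun t => betweenRoots (modelRoot K N H) t ^ (N - 1) :=
    funext (modelDensity_of_one_lt hN H K)
  have hmeas : Measurable (modelDensity H K N) := by
    rw [heq]; exact (measurable_betweenRoots hc).pow_const _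
  have hev := betweenRoots_eventuallyEq hc h0
  refine ⟨hmeas, fun t => ?_, ?_, ?_, fun a b => ?_⟩
  · rw [heq]; exact Real.rpow_nonneg (betweenRoots_nonneg hc h0 t) _
  · rw [heq]
    exact (hc.continuousAt.congr hev.symm).rpow_const (Or.inr hN1.le)
  · rw [heq]; simp [hev.eq_of_nhds]
  · have hdom : IntervalIntegrable (fun t => |modelRoot K N H t| ^ (N - 1)) volume a b :=
      (hc.abs.rpow_const fun _ => Or.inr hN1.le).intervalIntegrable a b
    refine hdom.mono_fun hmeas.aestronglyMeasurable (Eventually.of_forall fun t => ?_)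
    rw [heq]
    beta_reduce
    rw [Real.norm_of_nonneg (Real.rpow_nonneg (betweenRoots_nonneg hc h0 t) _),
      Real.norm_of_nonneg (by positivity)]
    refine Real.rpow_le_rpow (betweenRoots_nonneg hc h0 t) ?_ hN1.le
    exact (le_abs_self _).trans (abs_betweenRoots_le _ t)

theorem modelDensity_neg {H K N : ℝ} (hN : 1 ≤ N) (hH : N = 1 → K ≤ 0 ∧ H = 0) (t : ℝ) :
    modelDensity H K N (-t) = modelDensity (-H) K N t := by
  rcases hN.eq_or_lt with rfl | hN
  · obtain ⟨hK, rfl⟩ := hH rfl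
    simp [modelDensity_one_eq hK]
  rw [modelDensity_of_one_lt hN, modelDensity_of_one_lt hN, ← betweenRoots_comp_neg (by simp)]
  congr 2
  ext r
  exact modelRoot_neg K N H r

theorem one_le_modelDensity {K N : ℝ} (hN : 1 ≤ N) (hK : K ≤ 0) (t : ℝ) :
    1 ≤ modelDensity 0 K N t := by
  rcases hN.eq_or_lt with rfl | hN
  · simp [modelDensity_one_eq hK]
  have hN1 : 0 < N - 1 := by linarith
  have h1 : ∀ r, 1 ≤ modelRoot K N 0 r := fun r => by
    simpa [modelRoot] using one_le_cs (div_nonpos_of_nonpos_of_nonneg hK hN1.le) r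
  have hmem : t ∈ rootInterval (modelRoot K N 0) :=
    ⟨fun ξ _ h => by linarith [h1 ξ], fun ξ _ h => by linarith [h1 ξ]⟩
  rw [modelDensity_of_one_lt hN, betweenRoots_eq, indicator_of_mem hmem]
  exact Real.one_le_rpow (h1 t) hN1.le

/-- At `π / √(K / (N - 1))` the sine term vanishes and the cosine is `-1`, so a positive root occurs
by then, uniformly in `H`. -/
theorem exists_modelDensity_eq_zero {K N : ℝ} (hN : 1 < N) (hK : 0 < K) :
    ∃ R, 0 < R ∧ ∀ H t, R < t → modelDensity H K N t = 0 := by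
  have hN1 : 0 < N - 1 := by linarith
  have hδ : 0 < K / (N - 1) := by positivity
  have hs : 0 < √(K / (N - 1)) := Real.sqrt_pos.2 hδ
  refine ⟨Real.pi / √(K / (N - 1)), by positivity, fun H t ht => ?_⟩
  have hR : modelRoot K N H (Real.pi / √(K / (N - 1))) = -1 := by
    simp [modelRoot, cs, sn, hδ, mul_div_cancel₀ Real.pi hs.ne']
  obtain ⟨ξ, hξ, hξ0⟩ := intermediate_value_Icc' (by positivity)
    (continuous_modelRoot K N H).continuousOn
    (show (0 : ℝ) ∈ Icc (modelRoot K N H (Real.pi / √(K / (N - 1)))) (modelRoot K N H 0) by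
      rw [hR]; simp)
  have hpos : 0 < ξ := lt_of_le_of_ne hξ.1 fun h => by
    rw [← h] at hξ0; simp at hξ0
  have hnot : t ∉ rootInterval (modelRoot K N H) := fun h => by
    linarith [h.2 ξ hpos hξ0, hξ.2]
  rw [modelDensity_of_one_lt hN, betweenRoots_eq, indicator_of_notMem hnot,
    Real.zero_rpow hN1.ne']

/-! ### Comparison with the model profile -/

theorem IsModelDensity.mass_eq {f : ℝ → ℝ} (hf : IsModelDensity f) {s : ℝ} (hs : 0 ≤ s) :
    mass (intervalFrom 0 (ENNReal.ofReal s)) f = ENNReal.ofReal (∫ t in 0..s, f t) := by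
  rw [intervalFrom_ofReal 0 hs, zero_add, mass, intervalIntegral.integral_of_le hs,
    ← integral_Icc_eq_integral_Ioc, ofReal_integral_eq_lintegral_ofReal
      ((intervalIntegrable_iff_integrableOn_Icc_of_le hs).1 (hf.intervalIntegrable 0 s))
      (Eventually.of_forall hf.nonneg)]

theorem IsModelDensity.integral_nonneg {f : ℝ → ℝ} (hf : IsModelDensity f) {s : ℝ} (hs : 0 ≤ s) :
    0 ≤ ∫ t in 0..s, f t :=
  intervalIntegral.integral_nonneg hs fun t _ => hf.nonneg t

theorem IsModelDensity.integral_mono {f : ℝ → ℝ} (hf : IsModelDensity f) {s s' : ℝ} (hs : 0 ≤ s)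
    (hss : s ≤ s') : ∫ t in 0..s, f t ≤ ∫ t in 0..s', f t := by
  refine intervalIntegral.integral_mono_interval le_rfl hs hss (Eventually.of_forall hf.nonneg)
    (hf.intervalIntegrable 0 s')

theorem IsModelDensity.continuous_integral {f : ℝ → ℝ} (hf : IsModelDensity f) :
    Continuous fun s => ∫ t in 0..s, f t :=
  intervalIntegral.continuous_primitive hf.intervalIntegrable 0

theorem IsModelDensity.mass_ne_zero {f : ℝ → ℝ} (hf : IsModelDensity f) {D : ℝ≥0∞} (hD : 0 < D) :
    mass (intervalFrom 0 D) f ≠ 0 := by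
  have hev : ∀ᶠ t in 𝓝 (0 : ℝ), 0 < f t :=
    hf.continuousAt.eventually_const_lt (by rw [hf.apply_zero]; exact zero_lt_one)
  have hev2 : ∀ᶠ t in 𝓝 (0 : ℝ), ENNReal.ofReal t < D :=
    ENNReal.continuous_ofReal.continuousAt.eventually_lt_const (by simpa using hD)
  obtain ⟨ε, hε, hball⟩ := Metric.eventually_nhds_iff.1 (hev.and hev2)
  have hprop : ∀ t ∈ Ioo 0 ε, 0 < f t ∧ ENNReal.ofReal t < D := fun t ht => by
    refine hball ?_
    rw [Real.dist_eq, sub_zero, abs_of_pos ht.1]; exact ht.2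
  refine ((setLIntegral_pos_iff hf.measurable.ennreal_ofReal).2 ?_).ne'
  refine (isOpen_Ioo.measure_pos volume (nonempty_Ioo.2 hε)).trans_le (measure_mono fun t ht => ?_)
  exact ⟨by simpa using (hprop t ht).1, ht.1.le, by simpa using (hprop t ht).2.le⟩

theorem modelProfile_le_densityProfile (H K N : ℝ) {D : ℝ≥0∞} {s : ℝ} (hs : 0 ≤ s)
    (hsD : ENNReal.ofReal s ≤ D) (v : ℝ) :
    modelProfile K N D v ≤ densityProfile (intervalFrom (-s) D) (modelDensity H K N) v :=
  iInf_le_of_le H (iInf_le_of_le s (iInf_le_of_le ⟨hs, by simpa using hsD⟩ le_rfl))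

/-- Once `A` is exactly the share `v` of the total, `B` is the share `1 - v`, and either alternative
in `hp` says that `p * (A + B)` is at least 1. -/
theorem balance_aux {A B v p : ℝ} (hA : 0 ≤ A) (hB : 0 ≤ B) (hv : v ∈ Ioo (0 : ℝ) 1)
    (hbal : (1 - v) * A = v * B) (hp : v ≤ p * A ∨ 1 - v ≤ p * B) :
    A = v * (A + B) ∧ 0 < A ∧ 0 < B ∧ (A + B)⁻¹ ≤ p := by
  obtain ⟨hv0, hv1⟩ := hv
  have hv1' : 0 < 1 - v := by linarith
  have hAB : A = v * (A + B) := by linarith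
  have hBA : B = (1 - v) * (A + B) := by linarith
  have hsum : 1 ≤ p * (A + B) := by
    rcases hp with hp | hp
    · rw [hAB] at hp
      by_contra! hlt
      nlinarith
    · rw [hBA] at hp
      by_contra! hlt
      nlinarith
  have hpos : 0 < A + B := by
    by_contra! hle
    have : A + B = 0 := by linarith
    rw [this] at hsum
    linarith
  refine ⟨hAB, by rw [hAB]; positivity, by rw [hBA]; positivity, ?_⟩
  rw [inv_le_iff_one_le_mul₀ hpos]
  linarith

section Balance

variable {H K N : ℝ} {D : ℝ≥0∞} {s A B v p : ℝ}

theorem modelProfile_le_of_left (hN : 1 ≤ N) (hH : N = 1 → K ≤ 0 ∧ H = 0) (hs : 0 ≤ s)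
    (hsD : ENNReal.ofReal s ≤ D)
    (hA : mass (intervalFrom 0 (ENNReal.ofReal s)) (modelDensity (-H) K N) = ENNReal.ofReal A)
    (hB : mass (intervalFrom 0 (D - ENNReal.ofReal s)) (modelDensity H K N) = ENNReal.ofReal B)
    (hA0 : 0 ≤ A) (hB0 : 0 ≤ B) (hv : v ∈ Ioo (0 : ℝ) 1) (hbal : (1 - v) * A = v * B)
    (hp : v ≤ p * A ∨ 1 - v ≤ p * B) : modelProfile K N D v ≤ ENNReal.ofReal p := by
  obtain ⟨h1, h2, h3, h4⟩ := balance_aux hA0 hB0 hv hbal hp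
  have hf := isModelDensity_modelDensity (H := H) hN hH
  rw [← funext (modelDensity_neg hN hH)] at hA
  refine (modelProfile_le_densityProfile H K N hs hsD v).trans
    ((densityProfile_le_of_left_mass hf.measurable hf.continuousAt hf.apply_zero hs hsD hA hB
      (by simpa using h2) ?_).trans ?_)
  · rw [← ENNReal.ofReal_add hA0 hB0, ← ENNReal.ofReal_mul hv.1.le, ← h1]
  · rw [← ENNReal.ofReal_add hA0 hB0, ← ENNReal.ofReal_inv_of_pos (by positivity)]
    exact ENNReal.ofReal_le_ofReal h4

theorem modelProfile_le_of_right (hN : 1 ≤ N) (hH : N = 1 → K ≤ 0 ∧ H = 0) (hs : 0 ≤ s)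
    (hsD : ENNReal.ofReal s ≤ D)
    (hA : mass (intervalFrom 0 (ENNReal.ofReal s)) (modelDensity (-H) K N) = ENNReal.ofReal A)
    (hB : mass (intervalFrom 0 (D - ENNReal.ofReal s)) (modelDensity H K N) = ENNReal.ofReal B)
    (hA0 : 0 ≤ A) (hB0 : 0 ≤ B) (hv : v ∈ Ioo (0 : ℝ) 1) (hbal : (1 - v) * B = v * A)
    (hp : v ≤ p * B ∨ 1 - v ≤ p * A) : modelProfile K N D v ≤ ENNReal.ofReal p := by
  obtain ⟨h1, h2, h3, h4⟩ := balance_aux hB0 hA0 hv hbal hp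
  have hf := isModelDensity_modelDensity (H := H) hN hH
  rw [← funext (modelDensity_neg hN hH)] at hA
  rw [add_comm] at h1 h4
  refine (modelProfile_le_densityProfile H K N hs hsD v).trans
    ((densityProfile_le_of_right_mass hf.measurable hf.continuousAt hf.apply_zero hs hsD hA hB
      (by simpa using h3) ?_).trans ?_)
  · rw [← ENNReal.ofReal_add hA0 hB0, ← ENNReal.ofReal_mul hv.1.le, ← h1]
  · rw [← ENNReal.ofReal_add hA0 hB0, ← ENNReal.ofReal_inv_of_pos (by positivity)]
    exact ENNReal.ofReal_le_ofReal h4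

end Balance

/-- The masses `v` and `w` are at most `p` times the masses of the two halves of a model density on
an interval of length `D`. -/
def HalvesBound (K N : ℝ) (D v w p : ℝ≥0∞) : Prop :=
  ∃ H : ℝ, (N = 1 → K ≤ 0 ∧ H = 0) ∧ ∃ a b : ℝ≥0∞, a + b = D ∧
    v ≤ p * mass (intervalFrom 0 a) (modelDensity (-H) K N) ∧
    w ≤ p * mass (intervalFrom 0 b) (modelDensity H K N)

/-! ### Adding up comparisons with model halves, and passing to the model profile. -/

section HalvesBound

variable {K N : ℝ} {D v w p : ℝ≥0∞}

theorem HalvesBound.symm (h : HalvesBound K N D v w p) : HalvesBound K N D w v p := by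
  obtain ⟨H, hH, a, b, hab, h1, h2⟩ := h
  refine ⟨-H, fun h => by simpa using hH h, b, a, by rw [add_comm, hab], by simpa using h2, h1⟩

theorem HalvesBound.mono (h : HalvesBound K N D v w p) {v' w' p' : ℝ≥0∞} (hv : v' ≤ v) (hw : w' ≤ w)
    (hp : p ≤ p') : HalvesBound K N D v' w' p' := by
  obtain ⟨H, hH, a, b, hab, h1, h2⟩ := h
  exact ⟨H, hH, a, b, hab, (hv.trans h1).trans (by gcongr), (hw.trans h2).trans (by gcongr)⟩

theorem HalvesBound.scale (h : HalvesBound K N D v w p) {v' w' c : ℝ≥0∞} (hv : v' ≤ c * v)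
    (hw : w' ≤ c * w) : HalvesBound K N D v' w' (c * p) := by
  obtain ⟨H, hH, a, b, hab, h1, h2⟩ := h
  refine ⟨H, hH, a, b, hab, hv.trans ?_, hw.trans ?_⟩ <;> rw [mul_assoc] <;> gcongr

/-- With `A` the left model mass, `p * v₂ ≤ q * v ≤ q * (p * A)`; cancelling `p`, which must be
positive and finite, gives `v₂ ≤ q * A`. The model of the first bound thus serves the second piece
too. -/
theorem HalvesBound.add_of_le (h : HalvesBound K N D v w p) {v₂ w' q : ℝ≥0∞} (hp0 : p ≠ 0)
    (hp : p ≠ ⊤) (hle : p * v₂ ≤ q * v) (hw : w' ≤ w) : HalvesBound K N D (v + v₂) w' (p + q) := by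
  obtain ⟨H, hH, a, b, hab, h1, h2⟩ := h
  refine ⟨H, hH, a, b, hab, ?_, (hw.trans h2).trans (by gcongr; exact le_self_add)⟩
  rw [add_mul]
  refine add_le_add h1 ?_
  set A := mass (intervalFrom 0 a) (modelDensity (-H) K N)
  have : p * v₂ ≤ p * (q * A) := hle.trans (by
    calc q * v ≤ q * (p * A) := by gcongr
      _ = p * (q * A) := by ring)
  exact (ENNReal.mul_le_mul_iff_right hp0 hp).1 this

theorem HalvesBound.add {v₂ w₂ q w' : ℝ≥0∞} (h : HalvesBound K N D v w p)
    (h₂ : HalvesBound K N D v₂ w₂ q) (hp0 : p ≠ 0) (hp : p ≠ ⊤) (hq0 : q ≠ 0) (hq : q ≠ ⊤)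
    (hw : w' ≤ w) (hw₂ : w' ≤ w₂) : HalvesBound K N D (v + v₂) w' (p + q) := by
  rcases le_total (p * v₂) (q * v) with hle | hle
  · exact h.add_of_le hp0 hp hle hw
  · rw [add_comm v, add_comm p]
    exact h₂.add_of_le hq0 hq hle hw₂

/-- The cut of the model is moved until its left part has the share `v` (or, after reflection, its
right part). One half is not shortened in the process and keeps its bound, and then `balance_aux`
applies. -/
theorem HalvesBound.modelProfile_le {K N : ℝ} {D p : ℝ≥0∞} {v : ℝ} (hN : 1 ≤ N)
    (hNK : N = 1 → K ≤ 0) (hv : v ∈ Ioo (0 : ℝ) 1)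
    (h : HalvesBound K N D (ENNReal.ofReal v) (ENNReal.ofReal (1 - v)) p) :
    modelProfile K N D v ≤ p := by
  rcases eq_or_ne p ⊤ with rfl | hp
  · exact le_top
  obtain ⟨p, hp0, rfl⟩ : ∃ q : ℝ, 0 ≤ q ∧ p = ENNReal.ofReal q :=
    ⟨p.toReal, ENNReal.toReal_nonneg, (ENNReal.ofReal_toReal hp).symm⟩
  obtain ⟨H, hH, a, b, hab, h1, h2⟩ := h
  have hH' : N = 1 → K ≤ 0 ∧ -H = 0 := fun h => by simpa using hH h
  have hf := isModelDensity_modelDensity hN hH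
  have hg := isModelDensity_modelDensity hN hH'
  have hreal : ∀ {x y : ℝ}, 0 ≤ y → ENNReal.ofReal x ≤ ENNReal.ofReal p * ENNReal.ofReal y →
      x ≤ p * y := fun hy hxy => by
    rw [← ENNReal.ofReal_mul hp0] at hxy
    exact (ENNReal.ofReal_le_ofReal_iff (by positivity)).1 hxy
  rcases eq_or_ne D ⊤ with rfl | hD
  -- On a half-line with `K ≤ 0` the model with `H = 0` is at least 1, so it has infinite mass and
  -- its profile is 0 by convention.
  · rcases le_or_gt K 0 with hK | hK
    · have htop : mass (intervalFrom (-0) ⊤) (modelDensity 0 K N) = ⊤ := by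
        rw [neg_zero, intervalFrom_top, mass]
        refine top_unique ?_
        calc (⊤ : ℝ≥0∞) = ∫⁻ t in Ici (0 : ℝ), 1 := by simp
          _ ≤ _ := lintegral_mono fun t => by
            rw [← ENNReal.ofReal_one]
            exact ENNReal.ofReal_le_ofReal (one_le_modelDensity hN hK t)
      refine (modelProfile_le_densityProfile 0 K N le_rfl le_top v).trans ?_
      rw [densityProfile, htop]
      simp
    have hN1 : 1 < N := lt_of_le_of_ne hN fun h => (hNK h.symm).not_gt hK
    obtain ⟨R, hR, hzero⟩ := exists_modelDensity_eq_zero hN1 hK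
    have hmass : ∀ H' : ℝ, N = 1 → K ≤ 0 ∧ H' = 0 := fun _ h => absurd h hN1.ne'
    have hfull : ∀ H', mass (intervalFrom 0 ⊤) (modelDensity H' K N)
        = ENNReal.ofReal (∫ t in 0..R, modelDensity H' K N t) := fun H' => by
      rw [← (isModelDensity_modelDensity hN (hmass H')).mass_eq hR.le, intervalFrom_ofReal 0 hR.le,
        zero_add, intervalFrom_top, mass, mass]
      rw [← lintegral_indicator measurableSet_Ici, ← lintegral_indicator measurableSet_Icc]
      refine lintegral_congr fun t => ?_
      by_cases ht : t ∈ Icc 0 R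
      · rw [indicator_of_mem ht, indicator_of_mem (show t ∈ Ici 0 from ht.1)]
      · rw [indicator_of_notMem ht, indicator_apply_eq_zero]
        intro ht0
        rw [hzero H' t (by
          by_contra! hle
          exact ht ⟨ht0, by linarith⟩), ENNReal.ofReal_zero]
    have hA0 := hg.integral_nonneg hR.le
    have hB0 := hf.integral_nonneg hR.le
    have h1' := hreal hA0 (h1.trans (by
      rw [← hfull]; gcongr; exact mass_mono _ (intervalFrom_mono _ le_top)))
    have h2' := hreal hB0 (h2.trans (by
      rw [← hfull]; gcongr; exact mass_mono _ (intervalFrom_mono _ le_top)))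
    -- The half that is too heavy for the share is shortened to length `s`. The other one remains a
    -- full half-line, since `⊤ - s = ⊤`, and keeps its bound. If it is the right half that is
    -- shortened, the model is reflected.
    rcases le_total (v * ∫ t in 0..R, modelDensity H K N t)
      ((1 - v) * ∫ t in 0..R, modelDensity (-H) K N t) with hle | hle
    · obtain ⟨s, hs, hseq⟩ := intermediate_value_Icc hR.le
        (continuous_const.mul hg.continuous_integral :
          Continuous fun s => (1 - v) * ∫ t in 0..s, modelDensity (-H) K N t).continuousOn
        ⟨by simpa using mul_nonneg hv.1.le hB0, hle⟩
      exact modelProfile_le_of_left hN hH hs.1 le_top (hg.mass_eq hs.1)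
        (by rw [ENNReal.top_sub ENNReal.ofReal_ne_top]; exact hfull H) (hg.integral_nonneg hs.1) hB0
        hv hseq (Or.inr h2')
    · obtain ⟨s, hs, hseq⟩ := intermediate_value_Icc hR.le
        (continuous_const.mul hf.continuous_integral :
          Continuous fun s => v * ∫ t in 0..s, modelDensity H K N t).continuousOn
        ⟨by simpa using mul_nonneg (sub_nonneg.2 hv.2.le) hA0, hle⟩
      exact modelProfile_le_of_right hN hH' hs.1 le_top (by rw [neg_neg]; exact hf.mass_eq hs.1)
        (by rw [ENNReal.top_sub ENNReal.ofReal_ne_top]; exact hfull (-H))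
        (hf.integral_nonneg hs.1) hA0 hv hseq.symm (Or.inl h1')
  obtain ⟨a, ha, rfl⟩ : ∃ q : ℝ, 0 ≤ q ∧ a = ENNReal.ofReal q :=
    ⟨a.toReal, ENNReal.toReal_nonneg, (ENNReal.ofReal_toReal
      (ne_top_of_le_ne_top hD (hab ▸ le_self_add))).symm⟩
  obtain ⟨b, hb, rfl⟩ : ∃ q : ℝ, 0 ≤ q ∧ b = ENNReal.ofReal q :=
    ⟨b.toReal, ENNReal.toReal_nonneg, (ENNReal.ofReal_toReal
      (ne_top_of_le_ne_top hD (hab ▸ le_add_self))).symm⟩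
  rw [← ENNReal.ofReal_add ha hb] at hab
  subst hab
  rw [hg.mass_eq ha] at h1
  rw [hf.mass_eq hb] at h2
  have h1' := hreal (hg.integral_nonneg ha) h1
  have h2' := hreal (hf.integral_nonneg hb) h2
  have hcont : Continuous fun s => (1 - v) * (∫ t in 0..s, modelDensity (-H) K N t)
      - v * ∫ t in 0..(a + b - s), modelDensity H K N t :=
    (continuous_const.mul hg.continuous_integral).sub
      (continuous_const.mul (hf.continuous_integral.comp (by fun_prop)))
  obtain ⟨s, hs, hseq⟩ := intermediate_value_Icc (add_nonneg ha hb) hcont.continuousOn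
    (show (0 : ℝ) ∈ Icc _ _ by
      constructor
      · simpa using mul_nonneg hv.1.le (hf.integral_nonneg (add_nonneg ha hb))
      · simpa using mul_nonneg (sub_nonneg.2 hv.2.le) (hg.integral_nonneg (add_nonneg ha hb)))
  have hs' : 0 ≤ a + b - s := by linarith [hs.2]
  refine modelProfile_le_of_left hN hH hs.1 (ENNReal.ofReal_le_ofReal hs.2) (hg.mass_eq hs.1)
    (by rw [← ENNReal.ofReal_sub _ hs.1]; exact hf.mass_eq hs') (hg.integral_nonneg hs.1)
    (hf.integral_nonneg hs') hv (sub_eq_zero.1 hseq) ?_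
  -- The lengths still sum to `a + b`: either the left half has not become shorter, or the right one
  -- has not.
  rcases le_total a s with has | has
  · exact Or.inl (h1'.trans (mul_le_mul_of_nonneg_left (hg.integral_mono ha has) hp0))
  · exact Or.inr (h2'.trans (mul_le_mul_of_nonneg_left (hf.integral_mono hb (by linarith)) hp0))

end HalvesBound

namespace IsRegularDensity

variable {X I E : Set ℝ} {h : ℝ → ℝ} {K N : ℝ} {D : ℝ≥0∞}

/-- At every point of `I` the density `h` lies below a multiple of a translated model density. -/
def ModelComparison (K N : ℝ) (I : Set ℝ) (h : ℝ → ℝ) : Prop :=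
  ∀ x ∈ I, ∃ H : ℝ, (N = 1 → K ≤ 0 ∧ H = 0) ∧
    ∀ y ∈ I, h y ≤ h x * modelDensity H K N (y - x)

theorem measure_le_of_le (H : IsRegularDensity X I h) {A B : Set ℝ} {f : ℝ → ℝ} {c : ℝ}
    (hc : 0 ≤ c) {T : ℝ → ℝ} (hT : MeasurePreserving T volume volume) (hTe : MeasurableEmbedding T)
    (hA : MeasurableSet A) (hsub : ∀ y ∈ A ∩ I, T y ∈ B)
    (hle : ∀ y ∈ I, h y ≤ c * f (T y)) :
    densityMeasure h A ≤ ENNReal.ofReal c * mass B f := by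
  have hI := H.isOpen.measurableSet
  have h0 : densityMeasure h A ≤ densityMeasure h (A ∩ I) := by
    refine (measure_mono (t := (A ∩ I) ∪ Iᶜ) fun x hx => ?_).trans ((measure_union_le _ _).trans ?_)
    · by_cases hxI : x ∈ I
      · exact Or.inl ⟨hx, hxI⟩
      · exact Or.inr hxI
    · rw [H.compl_null, add_zero]
  refine h0.trans ?_
  rw [densityMeasure, withDensity_apply _ (hA.inter hI), mass,
    ← lintegral_const_mul' _ _ ENNReal.ofReal_ne_top,
    ← hT.setLIntegral_comp_preimage_emb hTe (fun a => ENNReal.ofReal c * ENNReal.ofReal (f a)) B]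
  have hsub' : A ∩ I ⊆ T ⁻¹' B := hsub
  refine (setLIntegral_mono' (hA.inter hI) fun y hy => ?_).trans (lintegral_mono_set hsub')
  rw [← ENNReal.ofReal_mul hc]
  exact ENNReal.ofReal_le_ofReal (hle y hy.2)

/-- A one-dimensional Heintze–Karcher estimate: the supporting model at `x` is integrated over both
sides. Reflection turns the left side into the model with `-H`, and `x` splits the length `D` into
`x` and `D - x`. -/
theorem halvesBound_Iio (H : IsRegularDensity (intervalFrom 0 D) I h)
    (hN : 1 ≤ N) (hcomp : ModelComparison K N I h) {x : ℝ} (hx : x ∈ I) :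
    HalvesBound K N D (densityMeasure h (Iio x)) (densityMeasure h (Ioi x))
      (ENNReal.ofReal (h x)) := by
  obtain ⟨k, hk, hle⟩ := hcomp x hx
  have hxX := H.subset hx
  have hx0 : 0 ≤ x := hxX.1
  have hxD : ENNReal.ofReal x ≤ D := by simpa using hxX.2
  refine ⟨k, hk, ENNReal.ofReal x, D - ENNReal.ofReal x, add_tsub_cancel_of_le hxD, ?_, ?_⟩
  · refine H.measure_le_of_le (H.nonneg x) (T := fun y => x - y)
      (Measure.measurePreserving_sub_left volume x) (MeasurableEquiv.subLeft x).measurableEmbedding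
      measurableSet_Iio (fun y hy => ?_) fun y hy => ?_
    · rw [intervalFrom_ofReal 0 hx0]
      exact ⟨by linarith [mem_Iio.1 hy.1], by linarith [(H.subset hy.2).1]⟩
    · rw [← modelDensity_neg hN hk, neg_sub]
      exact hle y hy
  · refine H.measure_le_of_le (H.nonneg x) (T := fun y => y - x)
      (measurePreserving_sub_right volume x) (MeasurableEquiv.subRight x).measurableEmbedding
      measurableSet_Ioi (fun y hy => ⟨by linarith [mem_Ioi.1 hy.1], ?_⟩) hle
    have h2 := (H.subset hy.2).2
    have h1 := mem_Ioi.1 hy.1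
    rw [sub_zero] at h2 ⊢
    rw [ENNReal.le_sub_iff_add_le_right ENNReal.ofReal_ne_top hxD,
      ← ENNReal.ofReal_add (by linarith) hx0]
    simpa using h2

/-- `C` lies on one side of each of its ends, while its complement is the sum of the tails beyond
them. Hence the bounds are added with the roles of the two masses exchanged. An end outside `I` has
a null tail; this cannot happen at both ends since the complement has mass. -/
theorem halvesBound_component (H : IsRegularDensity (intervalFrom 0 D) I h)
    (hN : 1 ≤ N) (hcomp : ModelComparison K N I h) {C : Set ℝ}
    (hC : IsComponent (essInterior (densityMeasure h) I E) C) (hne : densityMeasure h Cᶜ ≠ 0) :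
    HalvesBound K N D (densityMeasure h C) (densityMeasure h Cᶜ) (upperCost I h C + lowerCost I h C)
      ∧ upperCost I h C + lowerCost I h C ≠ 0 := by
  have hCI := hC.subset.trans essInterior_subset
  have hsub := measure_mono (μ := densityMeasure h) (compl_subset_bounds hC.ordConnected)
  have hpos : ∀ {x}, x ∈ I → ENNReal.ofReal (h x) ≠ 0 := fun hx => by simpa using H.pos _ hx
  have hU := isOpen_essInterior (m := densityMeasure h) (E := E) H.isOpen
  have hup : ∀ {r}, IsLUB C r → densityMeasure h (upperBounds C) ≤ densityMeasure h (Ioi r) ∧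
      densityMeasure h C ≤ densityMeasure h (Iio r) := fun {r} hr => by
    constructor
    · rw [hr.upperBounds_eq, ← Ioi_union_left]
      refine (measure_union_le _ _).trans ?_
      rw [densityMeasure_countable h (countable_singleton r), add_zero]
    · exact measure_mono fun x hx => lt_of_le_of_ne (hr.1 hx) fun heq =>
        hC.isLUB_notMem hU hr (heq ▸ hC.subset hx)
  have hlow : ∀ {r}, IsGLB C r → densityMeasure h (lowerBounds C) ≤ densityMeasure h (Iio r) ∧
      densityMeasure h C ≤ densityMeasure h (Ioi r) := fun {r} hr => by
    constructor
    · rw [hr.lowerBounds_eq, ← Iio_union_right]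
      refine (measure_union_le _ _).trans ?_
      rw [densityMeasure_countable h (countable_singleton r), add_zero]
    · exact measure_mono fun x hx => lt_of_le_of_ne (hr.1 hx) fun heq =>
        hC.isGLB_notMem hU hr (heq ▸ hC.subset hx)
  have hsub' := hsub.trans (measure_union_le _ _)
  unfold upperCost lowerCost
  by_cases hu : BddAbove C ∧ sSup C ∈ I
  · obtain ⟨hu1, hu2⟩ := hup (isLUB_csSup hC.nonempty hu.1)
    have hbu := H.halvesBound_Iio hN hcomp hu.2
    rw [if_pos hu]
    refine ⟨?_, by simp [hpos hu.2]⟩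
    by_cases hl : BddBelow C ∧ sInf C ∈ I
    · obtain ⟨hl1, hl2⟩ := hlow (isGLB_csInf hC.nonempty hl.1)
      have hbl := H.halvesBound_Iio hN hcomp hl.2
      rw [if_pos hl]
      exact (hbu.symm.add hbl (hpos hu.2) ENNReal.ofReal_ne_top (hpos hl.2) ENNReal.ofReal_ne_top
        hu2 hl2).symm.mono le_rfl (hsub'.trans (add_le_add hu1 hl1)) le_rfl
    · rw [if_neg hl]
      rw [H.measure_lowerBounds hC.nonempty hCI hl, add_zero] at hsub'
      exact hbu.mono hu2 (hsub'.trans hu1) le_self_add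
  · rw [if_neg hu, zero_add]
    rw [H.measure_upperBounds hC.nonempty hCI hu, zero_add] at hsub'
    by_cases hl : BddBelow C ∧ sInf C ∈ I
    · obtain ⟨hl1, hl2⟩ := hlow (isGLB_csInf hC.nonempty hl.1)
      rw [if_pos hl]
      exact ⟨(H.halvesBound_Iio hN hcomp hl.2).symm.mono hl2 (hsub'.trans hl1) le_rfl, hpos hl.2⟩
    · rw [H.measure_lowerBounds hC.nonempty hCI hl] at hsub'
      exact absurd (le_antisymm hsub' zero_le) hne

theorem cost_ne_top (C : Set ℝ) : upperCost I h C + lowerCost I h C ≠ ⊤ := by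
  unfold upperCost lowerCost
  split_ifs <;> simp

/-- The masses of disjoint components add, while the complement of the union lies in each
complement, as `HalvesBound.add` requires. -/
theorem halvesBound_biUnion (H : IsRegularDensity (intervalFrom 0 D) I h)
    (hN : 1 ≤ N) (hcomp : ModelComparison K N I h)
    (hne : densityMeasure h (essInterior (densityMeasure h) I E)ᶜ ≠ 0) (F : Finset (Set ℝ))
    (hF0 : F.Nonempty) (hF : ∀ C ∈ F, IsComponent (essInterior (densityMeasure h) I E) C) :
    HalvesBound K N D (densityMeasure h (⋃ C ∈ F, C)) (densityMeasure h (⋃ C ∈ F, C)ᶜ)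
      (∑ C ∈ F, (upperCost I h C + lowerCost I h C)) ∧
      ∑ C ∈ F, (upperCost I h C + lowerCost I h C) ≠ 0 := by
  have hcompl : ∀ C, IsComponent (essInterior (densityMeasure h) I E) C →
      densityMeasure h Cᶜ ≠ 0 := fun C hC h0 =>
    hne (measure_mono_null (compl_subset_compl.2 hC.subset) h0)
  induction hF0 using Finset.Nonempty.cons_induction with
  | singleton C =>
    have hC := hF C (by simp)
    simpa using H.halvesBound_component hN hcomp hC (hcompl C hC)
  | cons C F hCF hF0 ih =>
    have hC := hF C (by simp)
    obtain ⟨h1, h1'⟩ := H.halvesBound_component hN hcomp hC (hcompl C hC)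
    have hF' : ∀ C ∈ F, IsComponent (essInterior (densityMeasure h) I E) C :=
      fun C hC => hF C (by simp [hC])
    obtain ⟨h2, h2'⟩ := ih hF'
    have hunion : (⋃ C' ∈ Finset.cons C F hCF, C') = C ∪ ⋃ C' ∈ F, C' := by
      simp [iUnion_or, iUnion_union_distrib]
    have hdisj : Disjoint C (⋃ C' ∈ F, C') := by
      rw [disjoint_iUnion₂_right]
      exact fun C' hC' => hC.disjoint (hF' C' hC') fun heq => hCF (heq ▸ hC')
    rw [Finset.sum_cons, hunion, measure_union hdisj
      (F.measurableSet_biUnion fun C hC => H.measurableSet_component (hF' C hC))]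
    refine ⟨h1.add h2 h1' (cost_ne_top C) h2' ?_ (measure_mono ?_) (measure_mono ?_), by simp [h2']⟩
    · exact ENNReal.sum_ne_top.2 fun C _ => cost_ne_top C
    · exact compl_subset_compl.2 subset_union_left
    · exact compl_subset_compl.2 subset_union_right

theorem modelProfile_le_perimeter (H : IsRegularDensity (intervalFrom 0 D) I h)
    (hN : 1 ≤ N) (hNK : N = 1 → K ≤ 0) (hcomp : ModelComparison K N I h) (hE : MeasurableSet E)
    {v : ℝ} (hv : v ∈ Ioo (0 : ℝ) 1) (hEv : densityMeasure h E = ENNReal.ofReal v) :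
    modelProfile K N D v ≤ perimeter (intervalFrom 0 D) (densityMeasure h) E := by
  have := H.isProbabilityMeasure
  by_cases hP : perimeter (intervalFrom 0 D) (densityMeasure h) E = ⊤
  · simp [hP]
  set U := essInterior (densityMeasure h) I E with hUdef
  have hU : densityMeasure h U = ENNReal.ofReal v := (H.measure_essInterior hE hP).trans hEv
  have hUo : IsOpen U := isOpen_essInterior H.isOpen
  have hUc : densityMeasure h Uᶜ = ENNReal.ofReal (1 - v) := by
    rw [prob_compl_eq_one_sub hUo.measurableSet, hU, ← ENNReal.ofReal_one,
      ENNReal.ofReal_sub _ hv.1.le]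
  have hlim : Tendsto (fun c : ℝ => ENNReal.ofReal c *
      perimeter (intervalFrom 0 D) (densityMeasure h) E) (𝓝[>] 1)
      (𝓝 (perimeter (intervalFrom 0 D) (densityMeasure h) E)) := by
    have := ENNReal.Tendsto.mul_const (b := perimeter (intervalFrom 0 D) (densityMeasure h) E)
      (ENNReal.tendsto_ofReal (tendsto_id.mono_left nhdsWithin_le_nhds :
        Tendsto (fun c : ℝ => c) (𝓝[>] 1) (𝓝 1))) (Or.inr hP)
    simpa using this
  refine ge_of_tendsto hlim ?_
  filter_upwards [self_mem_nhdsWithin] with c hc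
  rw [mem_Ioi] at hc
  have hc0 : 0 < c := zero_lt_one.trans hc
  -- Finitely many components carry more than `v / c`; enlarging the cost by the factor `c` restores
  -- `v`, and `c` tends to 1.
  have hlt : ENNReal.ofReal (v / c) < densityMeasure h U := by
    rw [hU, ENNReal.ofReal_lt_ofReal_iff hv.1]
    exact div_lt_self hv.1 hc
  obtain ⟨F, hF, hFlt⟩ := exists_finset_components hUo hlt
  have hF0 : F.Nonempty := by
    rw [Finset.nonempty_iff_ne_empty]
    rintro rfl
    simp at hFlt
  obtain ⟨hb, -⟩ := H.halvesBound_biUnion hN hcomp (by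
    rw [hUc]; simpa using hv.2) F hF0 hF
  refine HalvesBound.modelProfile_le hN hNK hv (((hb.mono le_rfl le_rfl
    (H.sum_cost_le_perimeter hE F hF))).scale ?_ ?_)
  · calc ENNReal.ofReal v = ENNReal.ofReal c * ENNReal.ofReal (v / c) := by
          rw [← ENNReal.ofReal_mul hc0.le, mul_div_cancel₀ _ hc0.ne']
      _ ≤ _ := by gcongr
  · rw [← hUc]
    refine (measure_mono (compl_subset_compl.2 (iUnion₂_subset fun C hC => (hF C hC).subset))).trans
      ?_
    exact le_mul_of_one_le_left zero_le (ENNReal.one_le_ofReal.2 hc.le)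

theorem modelProfile_le_perimeterProfile (H : IsRegularDensity (intervalFrom 0 D) I h)
    (hD : 0 < D) (hN : 1 ≤ N) (hNK : N = 1 → K ≤ 0) (hcomp : ModelComparison K N I h)
    {v : ℝ} (hv : v ∈ Icc (0 : ℝ) 1) :
    modelProfile K N D v ≤ perimeterProfile (intervalFrom 0 D) (densityMeasure h) v := by
  have hmass : mass (intervalFrom (-0) D) (modelDensity 0 K N) ≠ 0 := by
    rw [neg_zero]
    exact (isModelDensity_modelDensity hN fun h => ⟨hNK h, rfl⟩).mass_ne_zero hD
  have hle := modelProfile_le_densityProfile 0 K N (D := D) le_rfl (by simp) v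
  rcases hv.1.eq_or_lt with rfl | h0
  · rw [densityProfile_zero hmass] at hle
    exact hle.trans zero_le
  rcases hv.2.eq_or_lt with rfl | h1
  · rw [densityProfile_one (measurableSet_intervalFrom _ _) hmass] at hle
    exact hle.trans zero_le
  exact le_iInf fun E => le_iInf fun _ => le_iInf fun hE => le_iInf fun hEv =>
    H.modelProfile_le_perimeter hN hNK hcomp hE ⟨h0, h1⟩ hEv

end IsRegularDensity

/-! ### Densities of curvature-dimension type -/

theorem sn_add (δ a b : ℝ) : sn δ (a + b) = sn δ a * cs δ b + cs δ a * sn δ b := by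
  unfold sn cs
  split_ifs with h1 h2
  · rw [mul_add, Real.sin_add]; ring
  · ring
  · rw [mul_add, Real.sinh_add]; ring

theorem sn_pos {δ t : ℝ} (ht : 0 < t) (hδ : δ * t ^ 2 < Real.pi ^ 2) : 0 < sn δ t := by
  unfold sn
  split_ifs with h1 h2
  · have hs := Real.sqrt_pos.2 h1
    refine div_pos (Real.sin_pos_of_pos_of_lt_pi (by positivity) ?_) hs
    refine lt_of_pow_lt_pow_left₀ 2 Real.pi_pos.le ?_
    rwa [mul_pow, Real.sq_sqrt h1.le]
  · exact ht
  · have hs : 0 < √(-δ) := Real.sqrt_pos.2 (by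
      rcases lt_or_eq_of_le (not_lt.1 h1) with h | h
      · linarith
      · exact absurd h h2)
    exact div_pos (Real.sinh_pos_iff.2 (by positivity)) hs

theorem distortion_eq {K M t θ : ℝ} (hM : 0 < M) (hθ : 0 < θ)
    (h : K * θ ^ 2 < M * Real.pi ^ 2) :
    distortion K M t θ = ENNReal.ofReal (sn (K / M) (t * θ) / sn (K / M) θ) := by
  have hθ2 : 0 < θ ^ 2 := by positivity
  unfold distortion sn
  rw [if_neg h.not_ge]
  rcases lt_trichotomy K 0 with hK | rfl | hK
  · have h1 : ¬0 < K * θ ^ 2 := by nlinarith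
    have h2 : ¬(K * θ ^ 2 = 0 ∨ M = 0) := by
      push Not; exact ⟨by nlinarith, hM.ne'⟩
    have h3 : K / M < 0 := div_neg_of_neg_of_pos hK hM
    rw [if_neg h1, if_neg h2, if_neg h3.not_gt, if_neg h3.ne, if_neg h3.not_gt, if_neg h3.ne,
      div_div_div_cancel_right₀ (Real.sqrt_pos.2 (by linarith)).ne', neg_div, mul_comm _ (√_),
      mul_comm θ (√_)]
  · simp [hθ.ne']
  · have h1 : 0 < K * θ ^ 2 := by positivity
    have h3 : 0 < K / M := by positivity
    rw [if_pos h1, if_pos h3, if_pos h3, div_div_div_cancel_right₀ (Real.sqrt_pos.2 h3).ne',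
      mul_comm _ (√_), mul_comm θ (√_)]

section Curvature

variable {K N : ℝ} {h : ℝ → ℝ} {S : Set ℝ}

/-- Otherwise the coefficient is infinite, and at `s = 0` the inequality fails because `h t₀` is
positive. -/
theorem CurvatureInequality.lt_pi (hc : CurvatureInequality K N h S) {t₀ t₁ : ℝ} (h₀ : t₀ ∈ S)
    (h₁ : t₁ ∈ S) (hlt : t₀ < t₁) (hpos : 0 < h t₀) :
    K * (t₁ - t₀) ^ 2 < (N - 1) * Real.pi ^ 2 := by
  by_contra! hle
  have := hc t₀ h₀ t₁ h₁ hlt 0 (by simp)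
  have hne : ENNReal.ofReal (h t₀ ^ (1 / (N - 1))) ≠ 0 := by
    simpa using Real.rpow_pos_of_pos hpos _
  simp only [distortion, if_pos hle, ENNReal.top_mul hne, top_add] at this
  exact ENNReal.ofReal_ne_top (top_unique this)

/-- The three-point form of concavity relative to `sn`, with denominators cleared; the positivity
statements permit dividing again. -/
theorem CurvatureInequality.sn_mul_add_le (hN : 1 < N) (hc : CurvatureInequality K N h S)
    (hh : ∀ t, 0 ≤ h t) {t₀ t₁ x : ℝ} (h₀ : t₀ ∈ S) (h₁ : t₁ ∈ S) (hx₀ : t₀ < x) (hx₁ : x < t₁)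
    (hpos : 0 < h t₀) :
    sn (K / (N - 1)) (t₁ - x) * h t₀ ^ (1 / (N - 1)) + sn (K / (N - 1)) (x - t₀) * h t₁ ^ (1 / (N - 1))
      ≤ sn (K / (N - 1)) (t₁ - t₀) * h x ^ (1 / (N - 1)) ∧
    0 < sn (K / (N - 1)) (t₁ - x) ∧ 0 < sn (K / (N - 1)) (x - t₀) ∧
    0 < sn (K / (N - 1)) (t₁ - t₀) := by
  have hN1 : 0 < N - 1 := by linarith
  have hlt : t₀ < t₁ := hx₀.trans hx₁
  have hθ : 0 < t₁ - t₀ := by linarith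
  have hpi := hc.lt_pi h₀ h₁ hlt hpos
  have hsn : ∀ t, 0 < t → t ≤ t₁ - t₀ → 0 < sn (K / (N - 1)) t := fun t ht htle => by
    refine sn_pos ht ?_
    rw [div_mul_eq_mul_div, div_lt_iff₀ hN1, mul_comm (Real.pi ^ 2)]
    rcases le_or_gt K 0 with hK | hK
    · have : K * t ^ 2 ≤ 0 := mul_nonpos_of_nonpos_of_nonneg hK (by positivity)
      exact this.trans_lt (by positivity)
    · exact lt_of_le_of_lt (by gcongr) hpi
  have hs1 := hsn (t₁ - x) (by linarith) (by linarith)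
  have hs2 := hsn (x - t₀) (by linarith) (by linarith)
  have hs3 := hsn (t₁ - t₀) hθ le_rfl
  refine ⟨?_, hs1, hs2, hs3⟩
  have key := hc t₀ h₀ t₁ h₁ hlt ((x - t₀) / (t₁ - t₀))
    ⟨div_nonneg (by linarith) hθ.le, (div_le_one hθ).2 (by linarith)⟩
  have e1 : (1 - (x - t₀) / (t₁ - t₀)) * (t₁ - t₀) = t₁ - x := by field_simp; ring
  have e2 : (x - t₀) / (t₁ - t₀) * (t₁ - t₀) = x - t₀ := by field_simp
  have e3 : (1 - (x - t₀) / (t₁ - t₀)) * t₀ + (x - t₀) / (t₁ - t₀) * t₁ = x := by field_simp; ring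
  rw [distortion_eq hN1 hθ hpi, distortion_eq hN1 hθ hpi, e1, e2, e3] at key
  have hg : ∀ t, 0 ≤ h t ^ (1 / (N - 1)) := fun t => Real.rpow_nonneg (hh t) _
  rw [← ENNReal.ofReal_mul (by positivity), ← ENNReal.ofReal_mul (by positivity),
    ← ENNReal.ofReal_add (mul_nonneg (by positivity) (hg _)) (mul_nonneg (by positivity) (hg _)),
    ENNReal.ofReal_le_ofReal_iff (hg _), div_mul_eq_mul_div, div_mul_eq_mul_div, ← add_div,
    div_le_iff₀ hs3] at key
  linarith

theorem CurvatureInequality.pos_of_between (hN : 1 < N) (hc : CurvatureInequality K N h S)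
    (hh : ∀ t, 0 ≤ h t) {t₀ t₁ x : ℝ} (h₀ : t₀ ∈ S) (h₁ : t₁ ∈ S) (hx₀ : t₀ < x) (hx₁ : x < t₁)
    (hpos : 0 < h t₀) : 0 < h x := by
  obtain ⟨hle, hs1, hs2, hs3⟩ := hc.sn_mul_add_le hN hh h₀ h₁ hx₀ hx₁ hpos
  refine lt_of_le_of_ne (hh x) fun h0 => ?_
  have hN1 : 1 / (N - 1) ≠ 0 := (one_div_pos.2 (by linarith : 0 < N - 1)).ne'
  rw [← h0, Real.zero_rpow hN1, mul_zero] at hle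
  have := mul_pos hs1 (Real.rpow_pos_of_pos hpos (1 / (N - 1)))
  have := mul_nonneg hs2.le (Real.rpow_nonneg (hh t₁) (1 / (N - 1)))
  linarith

theorem CurvatureInequality.mono (hc : CurvatureInequality K N h S) {S' : Set ℝ} (hS : S' ⊆ S) :
    CurvatureInequality K N h S' :=
  fun t₀ h₀ t₁ h₁ => hc t₀ (hS h₀) t₁ (hS h₁)

/-- A density that satisfies the curvature-dimension inequality has a supporting model density at
every point. -/
theorem CurvatureInequality.exists_le (hN : 1 < N) {I : Set ℝ} (hI : IsOpen I)
    (hc : CurvatureInequality K N h I) (hh : ∀ t, 0 ≤ h t) (hpos : ∀ t ∈ I, 0 < h t) {x : ℝ}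
    (hx : x ∈ I) : ∃ H, ∀ y ∈ I,
      h y ^ (1 / (N - 1)) ≤ h x ^ (1 / (N - 1)) * modelRoot K N H (y - x) := by
  have hN1 : 0 < N - 1 := by linarith
  set g : ℝ → ℝ := fun t => h t ^ (1 / (N - 1)) with hg
  set δ := K / (N - 1) with hδ
  have hgx : 0 < g x := Real.rpow_pos_of_pos (hpos x hx) _
  obtain ⟨a, ha, hax⟩ : ∃ a ∈ I, a < x := by
    obtain ⟨ε, hε, hball⟩ := Metric.isOpen_iff.1 hI x hx
    refine ⟨x - ε / 2, hball ?_, by linarith⟩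
    rw [Metric.mem_ball, Real.dist_eq, abs_lt]; constructor <;> linarith
  obtain ⟨b, hb, hxb⟩ : ∃ b ∈ I, x < b := by
    obtain ⟨ε, hε, hball⟩ := Metric.isOpen_iff.1 hI x hx
    refine ⟨x + ε / 2, hball ?_, by linarith⟩
    rw [Metric.mem_ball, Real.dist_eq, abs_lt]; constructor <;> linarith
  -- The function `cs + k * sn` centred at `x` dominates `g / g x` exactly if `R y ≤ k` for `y` to
  -- the right of `x` and `k ≤ L z` for `z` to the left. By the addition formula for `sn`, the
  -- three-point inequality is `R y ≤ L z`, so the supremum of `R` is a valid `k`.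
  set R : ℝ → ℝ := fun y => (g y / g x - cs δ (y - x)) / sn δ (y - x) with hR
  set L : ℝ → ℝ := fun y => (cs δ (x - y) - g y / g x) / sn δ (x - y) with hL
  have hRL : ∀ y ∈ I, x < y → ∀ z ∈ I, z < x → R y ≤ L z := by
    intro y hy hxy z hz hzx
    obtain ⟨hle, hs1, hs2, hs3⟩ := hc.sn_mul_add_le hN hh hz hy hzx hxy (hpos z hz)
    rw [← hδ] at hle hs1 hs2 hs3
    have hadd : sn δ (y - z) = sn δ (y - x) * cs δ (x - z) + cs δ (y - x) * sn δ (x - z) := by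
      rw [← sn_add]; congr 1; ring
    change sn δ (y - x) * g z + sn δ (x - z) * g y ≤ sn δ (y - z) * g x at hle
    rw [hadd] at hle
    simp only [hR, hL]
    rw [div_le_div_iff₀ hs1 hs2, ← sub_nonneg]
    have e : (cs δ (x - z) - g z / g x) * sn δ (y - x) - (g y / g x - cs δ (y - x)) * sn δ (x - z)
        = ((sn δ (y - x) * cs δ (x - z) + cs δ (y - x) * sn δ (x - z)) * g x
          - (sn δ (y - x) * g z + sn δ (x - z) * g y)) / g x := by
      field_simp; ring
    rw [e]
    exact div_nonneg (by linarith) hgx.le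
  have hbdd : BddAbove (R '' (I ∩ Ioi x)) :=
    ⟨L a, by rintro _ ⟨y, hy, rfl⟩; exact hRL y hy.1 hy.2 a ha hax⟩
  set k := sSup (R '' (I ∩ Ioi x)) with hk
  refine ⟨k * (N - 1), fun y hy => ?_⟩
  have hroot : modelRoot K N (k * (N - 1)) (y - x) = cs δ (y - x) + k * sn δ (y - x) := by
    rw [modelRoot, mul_div_cancel_right₀ _ hN1.ne']
  change g y ≤ g x * _
  rw [hroot, ← div_le_iff₀' hgx]
  rcases lt_trichotomy x y with hlt | rfl | hlt
  · have hs := (hc.sn_mul_add_le hN hh ha hy hax hlt (hpos a ha)).2.1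
    have h1 : R y ≤ k := le_csSup hbdd ⟨y, ⟨hy, hlt⟩, rfl⟩
    simp only [hR] at h1
    rw [div_le_iff₀ hs] at h1
    linarith
  · simp [hgx.ne']
  · have hs := (hc.sn_mul_add_le hN hh hy hb hlt hxb (hpos y hy)).2.2.1
    have h1 : k ≤ L y := csSup_le ⟨R b, b, ⟨hb, hxb⟩, rfl⟩ (by
      rintro _ ⟨z, hz, rfl⟩; exact hRL z hz.1 hz.2 y hy hlt)
    simp only [hL] at h1
    rw [le_div_iff₀ hs] at h1
    have e1 : y - x = -(x - y) := by ring
    rw [e1, cs_neg, sn_neg]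
    linarith

/-- Positivity of `h` prevents the supporting solution from vanishing on `I`, so the translate of
`I` lies between its roots and the truncation has no effect there. -/
theorem CurvatureInequality.exists_le_modelDensity (hN : 1 < N) {I : Set ℝ} (hI : IsOpen I)
    (hIo : I.OrdConnected) (hc : CurvatureInequality K N h I) (hh : ∀ t, 0 ≤ h t)
    (hpos : ∀ t ∈ I, 0 < h t) {x : ℝ} (hx : x ∈ I) :
    ∃ H, ∀ y ∈ I, h y ≤ h x * modelDensity H K N (y - x) := by
  have hN1 : 0 < N - 1 := by linarith
  obtain ⟨H, hH⟩ := hc.exists_le hN hI hh hpos hx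
  refine ⟨H, fun y hy => ?_⟩
  have hgpos : ∀ t ∈ I, 0 < h t ^ (1 / (N - 1)) := fun t ht => Real.rpow_pos_of_pos (hpos t ht) _
  have hroot : ∀ ξ, x + ξ ∈ I → modelRoot K N H ξ ≠ 0 := fun ξ hξ h0 => by
    have := hH _ hξ
    rw [add_sub_cancel_left, h0, mul_zero] at this
    exact (hgpos _ hξ).not_ge this
  have hmem : y - x ∈ rootInterval (modelRoot K N H) := by
    refine ⟨fun ξ hξ h0 => ?_, fun ξ hξ h0 => ?_⟩
    · by_contra! hlt
      exact hroot ξ (hIo.out hy hx ⟨by linarith, by linarith⟩) h0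
    · by_contra! hlt
      exact hroot ξ (hIo.out hx hy ⟨by linarith, by linarith⟩) h0
  have hinv : ∀ t, (h t ^ (1 / (N - 1))) ^ (N - 1) = h t := fun t => by
    rw [← Real.rpow_mul (hh t), one_div_mul_cancel hN1.ne', Real.rpow_one]
  have hle := hH y hy
  have hnn : 0 ≤ modelRoot K N H (y - x) := by
    by_contra! hlt
    exact (hgpos y hy).not_ge (hle.trans (mul_nonpos_of_nonneg_of_nonpos (hgpos x hx).le hlt.le))
  rw [modelDensity_of_one_lt hN, betweenRoots_eq, indicator_of_mem hmem, ← hinv y, ← hinv x]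
  rw [← Real.mul_rpow (hgpos x hx).le hnn]
  exact Real.rpow_le_rpow (hgpos y hy).le hle hN1.le

end Curvature

/-! ### Measures of the family as regular densities. -/

section SyntheticFamily

variable {h : ℝ → ℝ}

theorem exists_pos_near_of_mem_support {x r : ℝ}
    (hx : x ∈ (densityMeasure h).support) (hr : 0 < r) : ∃ y ∈ Ioo (x - r) (x + r), 0 < h y := by
  by_contra! hcon
  have hmem : Ioo (x - r) (x + r) ∈ 𝓝 x := Ioo_mem_nhds (by linarith) (by linarith)
  refine ((Measure.mem_support_iff_forall x).1 hx _ hmem).ne' ?_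
  rw [densityMeasure, withDensity_apply _ measurableSet_Ioo, setLIntegral_congr_fun
    measurableSet_Ioo (fun y hy => by rw [ENNReal.ofReal_eq_zero.2 (hcon y hy)])]
  simp

/-- Near every support point the density is positive somewhere, and the curvature inequality
propagates positivity to all points in between. -/
theorem CurvatureInequality.ordConnected_support {K N : ℝ} (hN : 1 < N) (hh : ∀ t, 0 ≤ h t)
    (hoff : ∀ t, t ∉ (densityMeasure h).support → h t = 0)
    (hc : CurvatureInequality K N h (densityMeasure h).support) :
    (densityMeasure h).support.OrdConnected := by
  have hmem : ∀ t, 0 < h t → t ∈ (densityMeasure h).support := fun t ht => by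
    by_contra hcon
    exact ht.ne' (hoff t hcon)
  refine ⟨fun x hx y hy z hz => ?_⟩
  rcases hz.1.eq_or_lt with rfl | hxz
  · exact hx
  rcases hz.2.eq_or_lt with rfl | hzy
  · exact hy
  obtain ⟨t₀, ht₀, hp₀⟩ := exists_pos_near_of_mem_support hx (sub_pos.2 hxz)
  obtain ⟨t₁, ht₁, hp₁⟩ := exists_pos_near_of_mem_support hy (sub_pos.2 hzy)
  exact hmem z (hc.pos_of_between hN hh (hmem _ hp₀) (hmem _ hp₁) (by linarith [ht₀.2])
    (by linarith [ht₁.1]) hp₀)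

theorem isRegularDensity_of_support {X : Set ℝ} (hmeas : Measurable h) (hh : ∀ t, 0 ≤ h t)
    (hprob : IsProbabilityMeasure (densityMeasure h)) (hX : (densityMeasure h).support ⊆ X)
    (hord : (densityMeasure h).support.OrdConnected)
    (hcont : ContinuousOn h (densityMeasure h).support)
    (hpos : ∀ t ∈ interior (densityMeasure h).support, 0 < h t) :
    IsRegularDensity X (interior (densityMeasure h).support) h where
  measurable := hmeas
  nonneg := hh
  isOpen := isOpen_interior
  ordConnected := hord.convex.interior.ordConnected
  subset := interior_subset.trans hX
  continuousOn := hcont.mono interior_subset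
  pos := hpos
  isProbabilityMeasure := hprob
  compl_null := by
    refine measure_mono_null (t := (densityMeasure h).supportᶜ ∪ frontier (densityMeasure h).support)
      (fun x hx => ?_) (measure_union_null Measure.measure_compl_support
        (densityMeasure_absolutelyContinuous h (hord.convex.addHaar_frontier volume)))
    by_cases hxS : x ∈ (densityMeasure h).support
    · exact Or.inr ⟨subset_closure hxS, hx⟩
    · exact Or.inl hxS

/-- `I` is the interior of the support. The comparison is conditional because for `N = 1` and `K >
0` the model densities have no mass; for `N = 1` and `K ≤ 0` a constant is compared with the
constant model `H = 0`. -/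
theorem exists_isRegularDensity {K N : ℝ} (hN : 1 ≤ N) {D : ℝ≥0∞} {μ : Measure ℝ}
    (hμ : μ ∈ syntheticFamily K N D) :
    ∃ (I : Set ℝ) (h : ℝ → ℝ), μ = densityMeasure h ∧ IsRegularDensity (intervalFrom 0 D) I h ∧
      ((N = 1 → K ≤ 0) → IsRegularDensity.ModelComparison K N I h) := by
  obtain ⟨hprob, hsub, h, hmeas, hh, hoff, rfl, h1, h2⟩ := hμ
  refine ⟨interior (densityMeasure h).support, h, rfl, ?_⟩
  rcases hN.eq_or_lt with rfl | hN
  · obtain ⟨hord, c, hconst⟩ := h2 rfl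
    refine ⟨isRegularDensity_of_support hmeas hh hprob hsub hord
      (continuousOn_const.congr hconst) fun t ht => ?_, fun hK x hx => ⟨0, fun _ => ⟨hK rfl, rfl⟩,
        fun y hy => ?_⟩⟩
    · obtain ⟨y, -, hy⟩ := exists_pos_near_of_mem_support (interior_subset ht) one_pos
      have hyS : y ∈ (densityMeasure h).support := by
        by_contra hcon
        exact hy.ne' (hoff y hcon)
      rwa [hconst t (interior_subset ht), ← hconst y hyS]
    · rw [modelDensity_one_eq (hK rfl), mul_one, hconst x (interior_subset hx),
        hconst y (interior_subset hy)]
  · obtain ⟨hcont, hcurv⟩ := h1 hN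
    have hord := hcurv.ordConnected_support hN hh hoff
    have hpos : ∀ t ∈ interior (densityMeasure h).support, 0 < h t := fun t ht => by
      obtain ⟨ε, hε, hball⟩ := Metric.isOpen_iff.1 isOpen_interior t ht
      have hS : ∀ s, |s - t| < ε → s ∈ (densityMeasure h).support := fun s hs =>
        interior_subset (hball (by rwa [Metric.mem_ball, Real.dist_eq]))
      obtain ⟨t₀, ht₀, hp₀⟩ := exists_pos_near_of_mem_support
        (hS (t - ε / 2) (by rw [abs_lt]; constructor <;> linarith)) (half_pos hε)
      refine hcurv.pos_of_between hN hh (hS t₀ (by rw [abs_lt]; constructor <;>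
        linarith [ht₀.1, ht₀.2])) (hS (t + ε / 2) (by rw [abs_lt]; constructor <;> linarith))
        (by linarith [ht₀.2]) (by linarith) hp₀
    have hreg := isRegularDensity_of_support hmeas hh hprob hsub hord hcont hpos
    refine ⟨hreg, fun _ x hx => ?_⟩
    obtain ⟨H, hH⟩ := (hcurv.mono interior_subset).exists_le_modelDensity hN hreg.isOpen
      hreg.ordConnected hh hpos hx
    exact ⟨H, fun h => absurd h hN.ne', hH⟩

end SyntheticFamily

end Isoperimetric

end

theorem corollary3p2 (K N : ℝ) (hN : 1 ≤ N) (D : ℝ≥0∞) (hD : 0 < D) (μ : Measure ℝ)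
    (hμ : μ ∈ Isoperimetric.syntheticFamily K N D) (v : ℝ) (hv : v ∈ Icc (0 : ℝ) 1) :
    Isoperimetric.perimeterProfile (Isoperimetric.intervalFrom 0 D) μ v
        = Isoperimetric.contentProfile (Isoperimetric.intervalFrom 0 D) μ v ∧
      ((N = 1 → K ≤ 0) →
        Isoperimetric.modelProfile K N D v
          ≤ Isoperimetric.perimeterProfile (Isoperimetric.intervalFrom 0 D) μ v) := by
  obtain ⟨I, h, rfl, H, hcomp⟩ := Isoperimetric.exists_isRegularDensity hN hμ
  exact ⟨H.perimeterProfile_eq_contentProfile v,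
    fun hNK => H.modelProfile_le_perimeterProfile hD hN hNK (hcomp hNK) hv⟩
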